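/- Let $M$ be a smooth manifold of dimension $2n+1$ and let $\eta$ be a contact form on $M$, i.e. a smooth one-form with $\eta\wedge(d\eta)^n$ nowhere zero. Its Reeb vector field $\mathcal R$ is determined by $i_{\mathcal R}d\eta=0$, $\eta(\mathcal R)=1$; put $\bar\flat(v)=i_vd\eta+\eta(v)\eta$, $\sharp=\bar\flat^{-1}$ and $\sharp_\Lambda\alpha=\sharp\alpha-\alpha(\mathcal R)\mathcal R$. A submanifold $N$ is called Legendrian if $TN=\sharp_\Lambda(TN^\circ)$, where $TN^\circ$ is the annihilator of $TN$. On $TM\times\mathbb R$ consider the contact form $\bar\eta=\eta^C+t\,\eta^V$, where $t$ is the coordinate on $\mathbb R$ and $\eta^C$, $\eta^V$ are the complete and vertical lifts of $\eta$ to $TM$ (in coordinates $(x^i,v^i)$ of $TM$, $\eta^C=v^j\frac{\partial\eta_i}{\partial x^j}dx^i+\eta_i\,dv^i$ and $\eta^V=\eta_i\,dx^i$). For a smooth vector field $X$ and $f\in C^\infty(M)$ let $X\times f:M\to TM\times\mathbb R$, $p\mapsto(X_p,f(p))$. A pair $(g,X)$ is called an infinitesimal conformal contactomorphism if $\mathcal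 L_X\eta=g\,\eta$. **Theorem.** (1) For every smooth vector field $X$ and every $f\in C^\infty(M)$, the image $\mathrm{im}(X\times f)$ is a Legendrian submanifold of $(TM\times\mathbb R,\bar\eta)$ if and only if $(-f,X)$ is an infinitesimal conformal contactomorphism, i.e. $\mathcal L_X\eta=-f\,\eta$. (2) Consequently, for every $H\in C^\infty(M)$ with contact Hamiltonian vector field $X_H=\sharp_\Lambda(dH)-H\mathcal R$, the image $\mathrm{im}(X_H\times\mathcal R(H))$ is a Legendrian submanifold of $(TM\times\mathbb R,\bar\eta)$. -/

import Mathlib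

open scoped Manifold ContDiff Topology
open Bundle

noncomputable section

namespace ContactGeometry

section Forms

variable {E H M : Type*} [NormedAddCommGroup E] [NormedSpace ℝ E] [TopologicalSpace H]
  (I : ModelWithCorners ℝ E H) [TopologicalSpace M] [ChartedSpace H M]

/-- Vector fields on `M`, without any regularity. -/
abbrev VField (M : Type*) [TopologicalSpace M] [ChartedSpace H M] : Type _ :=
  (p : M) → TangentSpace I p

/-- One-forms on `M`, without any regularity. -/
abbrev OneForm (M : Type*) [TopologicalSpace M] [ChartedSpace H M] : Type _ :=
  (p : M) → TangentSpace I p →L[ℝ] ℝ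

/-- The differential of a real function as a one-form. -/
def diff (h : M → ℝ) : OneForm I M :=
  fun p => mfderiv I 𝓘(ℝ, ℝ) h p

/-- A vector field is smooth if it is a smooth section of the tangent bundle. -/
def IsSmoothVField [IsManifold I 1 M] (X : VField I M) : Prop :=
  ContMDiff I I.tangent ∞ (fun p => (⟨p, X p⟩ : TangentBundle I M))

/-- A one-form is smooth if it is a smooth section of the cotangent bundle `Hom(TM, ℝ)`. -/
def IsSmoothOneForm [IsManifold I 1 M] (η : OneForm I M) : Prop :=
  ContMDiff I (I.prod 𝓘(ℝ, E →L[ℝ] ℝ)) ∞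
    (fun p => TotalSpace.mk' (E →L[ℝ] ℝ)
      (E := fun p : M => TangentSpace I p →L[ℝ] Bundle.Trivial M ℝ p) p (η p))

/-- The coordinate expression of the one-form `η` in the chart `φ` around `p`: the pullback of `η`
along `φ⁻¹`, as a map from the model vector space to its dual. -/
def OneForm.inChart (η : OneForm I M) (p : M) : E → (E →L[ℝ] ℝ) := fun y =>
  (η ((extChartAt I p).symm y)).comp (mfderiv 𝓘(ℝ, E) I (extChartAt I p).symm y)

/-- The exterior derivative of a one-form on a manifold without boundary, at `p`, computed in the
chart `φ` around `p` and pulled back by `dφ`: `dη(u, v) = ∂ᵤη(v) - ∂ᵥη(u)`. (This is the normalization of `extDeriv`.) -/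
def extD (η : OneForm I M) (p : M) :
    TangentSpace I p →L[ℝ] TangentSpace I p →L[ℝ] ℝ :=
  let B : E →L[ℝ] E →L[ℝ] ℝ := fderiv ℝ (OneForm.inChart I η p) (extChartAt I p p)
  let φ : E →L[ℝ] E := mfderiv I 𝓘(ℝ, E) (extChartAt I p) p
  show E →L[ℝ] E →L[ℝ] ℝ from (B - B.flip).bilinearComp φ φ

/-- The Lie derivative of a one-form along a vector field,
`L_X η = i_X dη + d(η(X))` (Cartan's formula). -/
def lieDeriv (X : VField I M) (η : OneForm I M) : OneForm I M := fun p =>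
  extD I η p (X p) + diff I (fun q => η q (X q)) p

/-- The top-degree form `η ∧ (dη)ⁿ` at `p`, evaluated on `2n + 1` tangent vectors. -/
def contactVolume (n : ℕ) (η : OneForm I M) (p : M) (v : Fin (2 * n + 1) → TangentSpace I p) : ℝ :=
  (1 / 2 : ℝ) ^ n * ∑ σ : Equiv.Perm (Fin (2 * n + 1)), ((Equiv.Perm.sign σ : ℤ) : ℝ) *
    (η p (v (σ 0)) * ∏ i : Fin n,
      extD I η p (v (σ ⟨2 * (i : ℕ) + 1, by omega⟩)) (v (σ ⟨2 * (i : ℕ) + 2, by omega⟩)))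

/-- `η` is a contact form on the `(2n + 1)`-dimensional manifold `M`:
it is a smooth one-form and `η ∧ (dη)ⁿ` vanishes nowhere. -/
structure IsContactForm [IsManifold I 1 M] (n : ℕ) (η : OneForm I M) : Prop where
  finrank_eq : Module.finrank ℝ E = 2 * n + 1
  smooth : IsSmoothOneForm I η
  nonvanishing : ∀ p : M, ∃ v : Fin (2 * n + 1) → TangentSpace I p, contactVolume I n η p v ≠ 0

/-- The bundle map `v ↦ i_v dη + η(v) η` from the tangent to the cotangent space
(an isomorphism if `η` is a contact form). -/
def flat (η : OneForm I M) (p : M) : TangentSpace I p →L[ℝ] (TangentSpace I p →L[ℝ] ℝ) :=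
  extD I η p + (η p).smulRight (η p)

/-- The inverse of `flat`. -/
def sharp (η : OneForm I M) (p : M) : (TangentSpace I p →L[ℝ] ℝ) →L[ℝ] TangentSpace I p :=
  (flat I η p).inverse

/-- The Reeb vector field of a contact form: the unique `R` with `i_R dη = 0` and `η(R) = 1`. -/
def reeb (η : OneForm I M) : VField I M := fun p =>
  Classical.epsilon fun r : TangentSpace I p => extD I η p r = 0 ∧ η p r = 1

/-- `♯_Λ α = Λ(α, ·) = ♯ α - α(R) R`, where `Λ(α, β) = -dη(♯ α, ♯ β)` is the Jacobi bivector of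
the contact form `η`. -/
def sharpJacobi (η : OneForm I M) (p : M) (α : TangentSpace I p →L[ℝ] ℝ) : TangentSpace I p :=
  sharp I η p α - α (reeb I η p) • reeb I η p

/-- The contact complement `Δ^⊥ = ♯_Λ(Δ°)` of a set `Δ` of tangent vectors at `p`, where `Δ°` is
the annihilator of `Δ`. -/
def contactComplement (η : OneForm I M) (p : M) (Δ : Set (TangentSpace I p)) :
    Set (TangentSpace I p) :=
  sharpJacobi I η p '' {α : TangentSpace I p →L[ℝ] ℝ | ∀ v ∈ Δ, α v = 0}

/-- The function `R(h)` on `M`, the derivative of `h` along the Reeb vector field. -/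
def reebDeriv (η : OneForm I M) (h : M → ℝ) : M → ℝ := fun p =>
  diff I h p (reeb I η p)

/-- The contact Hamiltonian vector field `X_h = ♯_Λ(dh) - h R`. -/
def hamiltonianVField (η : OneForm I M) (h : M → ℝ) : VField I M := fun p =>
  sharpJacobi I η p (diff I h p) - h p • reeb I η p

/-- The pair `(g, X)` is an infinitesimal conformal contactomorphism: `L_X η = g η`. -/
def IsInfConformalContacto (η : OneForm I M) (g : M → ℝ) (X : VField I M) : Prop :=
  ∀ p : M, lieDeriv I X η p = g p • η p

/-- `N` is an (embedded, smooth) submanifold: near each of its points it is the zero set of a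
smooth submersion to `ℝᵐ`, where `m` is the codimension. -/
def IsSubmanifold (N : Set M) : Prop :=
  ∃ m : ℕ, ∀ x ∈ N, ∃ U : Set M, IsOpen U ∧ x ∈ U ∧ ∃ Φ : M → (Fin m → ℝ),
    ContMDiffOn I 𝓘(ℝ, Fin m → ℝ) ∞ Φ U ∧
    (∀ y ∈ U, Function.Surjective (mfderiv I 𝓘(ℝ, Fin m → ℝ) Φ y)) ∧
    ∀ y ∈ U, y ∈ N ↔ Φ y = 0

/-- The tangent space at `x` of a submanifold `N` containing `x`: all velocities at `x` of smooth
curves in `N` through `x`. -/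
def tangentVectors (N : Set M) (x : M) : Set (TangentSpace I x) :=
  {v | ∃ γ : ℝ → M, γ 0 = x ∧ (∃ ε > 0, ContMDiffOn 𝓘(ℝ, ℝ) I ∞ γ (Set.Ioo (-ε) ε) ∧
    ∀ s ∈ Set.Ioo (-ε) ε, γ s ∈ N) ∧ mfderiv 𝓘(ℝ, ℝ) I γ 0 (1 : ℝ) = v}

/-- `N` is a Legendrian submanifold with respect to the contact form `η`: it is a submanifold and
`TN = TN^⊥`. -/
def IsLegendrian (η : OneForm I M) (N : Set M) : Prop :=
  IsSubmanifold I N ∧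
    ∀ x ∈ N, tangentVectors I N x = contactComplement I η x (tangentVectors I N x)

end Forms

section TangentBundle

variable {E H M : Type*} [NormedAddCommGroup E] [NormedSpace ℝ E] [TopologicalSpace H]
  (I : ModelWithCorners ℝ E H) [TopologicalSpace M] [ChartedSpace H M] [IsManifold I 1 M]

/-- The vertical lift `η^V = τ^* η` of a one-form to the tangent bundle `τ : TM → M`;
in coordinates, `η^V = ηᵢ dxⁱ`. -/
def verticalLift (η : OneForm I M) : OneForm I.tangent (TangentBundle I M) := fun v =>
  (η v.proj).comp (mfderiv I.tangent I (fun w : TangentBundle I M => w.proj) v)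

/-- The complete lift `η^C` of a one-form to the tangent bundle `τ : TM → M`:
`η^C_v(w) = dη̂_v(w) + dη(v, τ_* w)` where `η̂ : TM → ℝ` is `v ↦ η(v)`;
in coordinates `(xⁱ, vⁱ)`, `η^C = vʲ (∂ηᵢ/∂xʲ) dxⁱ + ηᵢ dvⁱ`. It is the one-form
with `η^C(Y^C) = (η(Y))^C` for all vector fields `Y`. -/
def completeLift (η : OneForm I M) : OneForm I.tangent (TangentBundle I M) := fun v =>
  diff I.tangent (fun w : TangentBundle I M => η w.proj w.snd) v +
    (extD I η v.proj v.snd).comp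
      (mfderiv I.tangent I (fun w : TangentBundle I M => w.proj) v)

/-- The one-form `η^C + t η^V` on `TM × ℝ`, with `t` the coordinate on `ℝ`. -/
def contactification (η : OneForm I M) :
    OneForm (I.tangent.prod 𝓘(ℝ, ℝ)) (TangentBundle I M × ℝ) := fun q =>
  (completeLift I η q.1 + q.2 • verticalLift I η q.1).comp
    (mfderiv (I.tangent.prod 𝓘(ℝ, ℝ)) I.tangent
      (fun r : TangentBundle I M × ℝ => r.1) q)

/-- The map `X × f : M → TM × ℝ`, `p ↦ (X_p, f(p))`. -/
def vfieldProd (X : VField I M) (f : M → ℝ) : M → TangentBundle I M × ℝ := fun p =>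
  (⟨p, X p⟩, f p)

end TangentBundle

end ContactGeometry

end

/-! The whole theorem rests on one identity: the pullback of `η^C + t η^V` along `X × f` is `L_X η +
f η` (`contactification_mfderiv_vfieldProd`). The pairing `v ↦ η(v)` pulls back to `η(X)`, so the
two terms of the complete lift become the two terms of Cartan's formula. Hence `(-f, X)` is
conformal exactly when the tangent spaces of the image lie in `ker η̄`.

If the image is Legendrian, its tangent vectors have the form `♯_Λ α`, and these always lie in the
kernel of the contact form (`form_sharpJacobi`). Conversely, a vanishing pullback of `η̄` forces a
vanishing pullback of `dη̄`, because `d` is natural (`extD_pullback`), so the image is isotropic.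
Its dimension `m = dim M` is half that of `ker η̄`, since `dim (TM × ℝ) = 2m + 1`. A count of
dimensions then gives `T = ♯_Λ(T°)` (`range_eq_sharpJacobi_image`). This needs `η̄` to be contact at
each point, which is read off from a coordinate formula for `dη̄` (`IsContactPair.liftForm`,
`isContactPair_contactification`).

For the second part, `η(X_H) = -H` and `i_{X_H} dη = dH - R(H) η`, so Cartan's formula gives
`L_{X_H} η = -R(H) η`. To apply the first part one also needs `X_H` and `R(H)` to be smooth, which
follows from smoothness of operator inversion applied to `♭` in a chart. -/

noncomputable section

namespace ContactGeometry

/-! ### Linear algebra of a contact form at a point -/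

section LinearAlgebra

set_option linter.unusedSectionVars false

variable {V W : Type*} [AddCommGroup V] [Module ℝ V] [TopologicalSpace V]
  [IsTopologicalAddGroup V] [ContinuousSMul ℝ V]

/-- A skew form `Ω` and a linear form `θ` on `V` form a contact pair if `Ω` is nondegenerate on
`ker θ` and there is a Reeb vector. -/
structure IsContactPair (Ω : V →L[ℝ] V →L[ℝ] ℝ) (θ : V →L[ℝ] ℝ) : Prop where
  skew : ∀ u v, Ω u v = -Ω v u
  exists_reeb : ∃ r, Ω r = 0 ∧ θ r = 1
  eq_zero : ∀ v, θ v = 0 → Ω v = 0 → v = 0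

namespace IsContactPair

variable {Ω : V →L[ℝ] V →L[ℝ] ℝ} {θ : V →L[ℝ] ℝ}

lemma flat_injective (h : IsContactPair Ω θ) :
    Function.Injective (Ω + θ.smulRight θ) := by
  obtain ⟨r, hr, hr'⟩ := h.exists_reeb
  refine (injective_iff_map_eq_zero _).2 fun v hv => ?_
  -- Evaluating on the Reeb vector kills the `Ω` term and leaves `θ v`.
  have hθ : θ v = 0 := by
    have := DFunLike.congr_fun hv r
    simpa [h.skew v r, hr, hr'] using this
  refine h.eq_zero v hθ ?_
  simpa [hθ] using hv

variable [FiniteDimensional ℝ V] [T2Space V]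

lemma flat_bijective (h : IsContactPair Ω θ) :
    Function.Bijective (Ω + θ.smulRight θ) := by
  refine ⟨h.flat_injective, ?_⟩
  let e : (V →ₗ[ℝ] ℝ) ≃ₗ[ℝ] (V →L[ℝ] ℝ) := LinearMap.toContinuousLinearMap
  have : FiniteDimensional ℝ (V →L[ℝ] ℝ) := e.finiteDimensional
  exact (LinearMap.injective_iff_surjective_of_finrank_eq_finrank
    (f := (Ω + θ.smulRight θ).toLinearMap)
    (by rw [← e.finrank_eq]; exact (Subspace.dual_finrank_eq (K := ℝ) (V := V)).symm)).1
    h.flat_injective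

lemma exists_equiv (h : IsContactPair Ω θ) :
    ∃ e : V ≃L[ℝ] (V →L[ℝ] ℝ), (e : V →L[ℝ] (V →L[ℝ] ℝ)) = Ω + θ.smulRight θ :=
  ⟨(LinearEquiv.ofBijective (Ω + θ.smulRight θ).toLinearMap h.flat_bijective).toContinuousLinearEquiv,
    by ext; rfl⟩

lemma sharp_flat (h : IsContactPair Ω θ) (v : V) :
    (Ω + θ.smulRight θ).inverse ((Ω + θ.smulRight θ) v) = v := by
  obtain ⟨e, he⟩ := h.exists_equiv
  simp [← he]

lemma flat_sharp (h : IsContactPair Ω θ) (α : V →L[ℝ] ℝ) :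
    Ω ((Ω + θ.smulRight θ).inverse α) + θ ((Ω + θ.smulRight θ).inverse α) • θ = α := by
  obtain ⟨e, he⟩ := h.exists_equiv
  calc _ = (Ω + θ.smulRight θ) ((Ω + θ.smulRight θ).inverse α) := by simp
    _ = α := by simp [← he]

lemma form_sharp (h : IsContactPair Ω θ) {r : V} (hr : Ω r = 0) (hr' : θ r = 1)
    (α : V →L[ℝ] ℝ) : θ ((Ω + θ.smulRight θ).inverse α) = α r := by
  have := DFunLike.congr_fun (h.flat_sharp α) r
  simpa [h.skew _ r, hr, hr'] using this

lemma form_sharpJacobi (h : IsContactPair Ω θ) {r : V} (hr : Ω r = 0) (hr' : θ r = 1)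
    (α : V →L[ℝ] ℝ) : θ ((Ω + θ.smulRight θ).inverse α - α r • r) = 0 := by
  simp [h.form_sharp hr hr', hr']

lemma skewForm_sharpJacobi (h : IsContactPair Ω θ) {r : V} (hr : Ω r = 0) (hr' : θ r = 1)
    (α : V →L[ℝ] ℝ) : Ω ((Ω + θ.smulRight θ).inverse α - α r • r) = α - α r • θ := by
  have := h.flat_sharp α
  rw [h.form_sharp hr hr'] at this
  rw [map_sub, map_smul, hr, smul_zero, sub_zero]
  exact eq_sub_of_add_eq this

/-- Maximal isotropic subspaces are Legendrian. The vectors of `ker θ` that are `Ω`-orthogonal to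
the range of `L` form a space of dimension exactly `dim W`. It contains the range, so it equals it.
Vectors `♯_Λ α` with `α` in the annihilator satisfy both conditions, because `Ω(♯_Λ α) = α - α(r)
θ`. -/
lemma range_eq_sharpJacobi_image [AddCommGroup W] [Module ℝ W] [FiniteDimensional ℝ W]
    (h : IsContactPair Ω θ) {r : V}
    (hr : Ω r = 0) (hr' : θ r = 1) (L : W →ₗ[ℝ] V) (hL : Function.Injective L)
    (hdim : Module.finrank ℝ V = 2 * Module.finrank ℝ W + 1)
    (hθ : ∀ w, θ (L w) = 0) (hΩ : ∀ w w', Ω (L w) (L w') = 0) :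
    Set.range L = (fun α : V →L[ℝ] ℝ => (Ω + θ.smulRight θ).inverse α - α r • r) ''
      {α | ∀ v ∈ Set.range L, α v = 0} := by
  have key (v : V) (hv : θ v = 0) (hv' : ∀ w, Ω v (L w) = 0) : v ∈ Set.range L := by
    let B : V →ₗ[ℝ] Module.Dual ℝ W :=
      { toFun := fun v => ((Ω v).toLinearMap).comp L
        map_add' := fun _ _ => by ext; simp
        map_smul' := fun _ _ => by ext; simp }
    let D : Submodule ℝ V := LinearMap.range L
    -- A functional on `W` is extended to `α` on `V` through a left inverse of `L`. On the range of
    -- `L` the `θ` term of `♭(♯ α) = α` drops out, so `♯ α` is a preimage.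
    have hB : Function.Surjective B := by
      intro β
      obtain ⟨g, hg⟩ := L.exists_leftInverse_of_injective (LinearMap.ker_eq_bot.2 hL)
      let α : V →L[ℝ] ℝ := LinearMap.toContinuousLinearMap (β.comp g)
      refine ⟨(Ω + θ.smulRight θ).inverse α, ?_⟩
      ext w
      have h1 := DFunLike.congr_fun (h.flat_sharp α) (L w)
      have h2 : g (L w) = w := DFunLike.congr_fun hg w
      simpa [hθ, α, B, h2] using h1
    have hK : Module.finrank ℝ (LinearMap.ker B) = Module.finrank ℝ W + 1 := by
      have h1 := LinearMap.finrank_range_add_finrank_ker B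
      rw [LinearMap.range_eq_top.2 hB, finrank_top, Subspace.dual_finrank_eq] at h1
      omega
    -- The Reeb vector lies in `ker B` and `θ r = 1`, so imposing `θ = 0` lowers the dimension from
    -- `dim W + 1` to `dim W`.
    let T : LinearMap.ker B →ₗ[ℝ] ℝ := θ.toLinearMap.comp (LinearMap.ker B).subtype
    have hrB : r ∈ LinearMap.ker B := by
      rw [LinearMap.mem_ker]; ext w; simp [B, hr]
    have hT : Function.Surjective T := fun c => ⟨c • ⟨r, hrB⟩, by simp [T, hr']⟩
    have hKT : Module.finrank ℝ (LinearMap.ker T) = Module.finrank ℝ W := by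
      have h1 := LinearMap.finrank_range_add_finrank_ker T
      rw [LinearMap.range_eq_top.2 hT, finrank_top, hK, Module.finrank_self] at h1
      omega
    let Z : Submodule ℝ V := (LinearMap.ker T).map (LinearMap.ker B).subtype
    have hZ : Module.finrank ℝ Z = Module.finrank ℝ W := by
      rw [← hKT]
      exact (Submodule.equivMapOfInjective _ (Submodule.injective_subtype _) _).finrank_eq.symm
    have hmem (z : V) : z ∈ Z ↔ θ z = 0 ∧ ∀ w, Ω z (L w) = 0 := by
      have hBz : B z = 0 ↔ ∀ w, Ω z (L w) = 0 := by
        rw [LinearMap.ext_iff]; exact Iff.rfl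
      constructor
      · rintro ⟨⟨y, hy⟩, hy', rfl⟩
        refine ⟨hy', ?_⟩
        exact fun w => DFunLike.congr_fun (LinearMap.mem_ker.1 hy) w
      · rintro ⟨h1, h2⟩
        exact ⟨⟨z, LinearMap.mem_ker.2 (hBz.2 h2)⟩, h1, rfl⟩
    have hDZ : D ≤ Z := by
      rintro _ ⟨w, rfl⟩
      exact (hmem _).2 ⟨hθ w, hΩ w⟩
    have hD : D = Z := Submodule.eq_of_le_of_finrank_eq hDZ
      (by rw [hZ]; exact LinearMap.finrank_range_of_inj hL)
    have : v ∈ D := hD ▸ (hmem v).2 ⟨hv, hv'⟩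
    exact this
  apply Set.Subset.antisymm
  · rintro _ ⟨w, rfl⟩
    refine ⟨Ω (L w), ?_, ?_⟩
    · rintro _ ⟨w', rfl⟩
      exact hΩ w w'
    -- The covector `i_{L w} Ω` annihilates the range by isotropy. It equals `♭(L w)` and vanishes
    -- on `r`, so `♯_Λ` returns `L w`.
    · have h1 : (Ω + θ.smulRight θ) (L w) = Ω (L w) := by simp [hθ]
      have h2 : Ω (L w) r = 0 := by simp [h.skew _ r, hr]
      change (Ω + θ.smulRight θ).inverse (Ω (L w)) - Ω (L w) r • r = L w
      rw [h2, ← h1, h.sharp_flat]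
      simp
  · rintro _ ⟨α, hα, rfl⟩
    refine key _ (h.form_sharpJacobi hr hr' α) fun w => ?_
    rw [h.skewForm_sharpJacobi hr hr']
    simp [hα _ ⟨w, rfl⟩, hθ]

end IsContactPair

end LinearAlgebra

/-! ### From `η ∧ (dη)ⁿ ≠ 0` to nondegeneracy -/

section Volume

variable {V : Type*} [AddCommGroup V] [Module ℝ V]

/-- Each slot `j` occurs in exactly one factor: in `θ` if `j = 0`, otherwise as the first or second
argument of the `k`-th `Ω`. Having one functional `ℓ` yields both multilinearity axioms at once. -/
lemma exists_linearMap_tensorPower_update (n : ℕ) (Ω : V →ₗ[ℝ] V →ₗ[ℝ] ℝ) (θ : V →ₗ[ℝ] ℝ)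
    [DecidableEq (Fin (2 * n + 1))] (v : Fin (2 * n + 1) → V) (j : Fin (2 * n + 1)) :
    ∃ ℓ : V →ₗ[ℝ] ℝ, ∀ x, θ (Function.update v j x 0) * ∏ i : Fin n,
      Ω (Function.update v j x ⟨2 * (i : ℕ) + 1, by omega⟩)
        (Function.update v j x ⟨2 * (i : ℕ) + 2, by omega⟩) = ℓ x := by
  have hup (i : Fin (2 * n + 1)) (h : (i : ℕ) ≠ j) (x : V) : Function.update v j x i = v i :=
    Function.update_of_ne (fun e => h (congrArg Fin.val e)) _ _
  have hself (i : Fin (2 * n + 1)) (h : (i : ℕ) = j) (x : V) : Function.update v j x i = x := by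
    obtain rfl : i = j := Fin.ext h
    exact Function.update_self _ _ _
  rcases Nat.eq_zero_or_pos (j : ℕ) with h0 | h0
  · refine ⟨(∏ i : Fin n, Ω (v ⟨2 * (i : ℕ) + 1, by omega⟩) (v ⟨2 * (i : ℕ) + 2, by omega⟩)) • θ,
      fun x => ?_⟩
    rw [hself 0 (by simp [h0]), LinearMap.smul_apply, smul_eq_mul, mul_comm]
    congr 1
    refine Finset.prod_congr rfl fun i _ => ?_
    rw [hup _ (by simp; omega), hup _ (by simp; omega)]
  obtain ⟨k, hk⟩ : ∃ k : Fin n, (j : ℕ) = 2 * k + 1 ∨ (j : ℕ) = 2 * k + 2 :=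
    ⟨⟨((j : ℕ) - 1) / 2, by omega⟩, by simp only; omega⟩
  let c : ℝ := θ (v 0) * ∏ i ∈ Finset.univ.erase k,
    Ω (v ⟨2 * (i : ℕ) + 1, by omega⟩) (v ⟨2 * (i : ℕ) + 2, by omega⟩)
  have hc (x : V) : θ (Function.update v j x 0) * ∏ i : Fin n,
      Ω (Function.update v j x ⟨2 * (i : ℕ) + 1, by omega⟩)
        (Function.update v j x ⟨2 * (i : ℕ) + 2, by omega⟩) =
      c * Ω (Function.update v j x ⟨2 * (k : ℕ) + 1, by omega⟩)
        (Function.update v j x ⟨2 * (k : ℕ) + 2, by omega⟩) := by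
    rw [hup 0 (by simp; omega), ← Finset.mul_prod_erase Finset.univ _ (Finset.mem_univ k)]
    have : ∏ i ∈ Finset.univ.erase k, Ω (Function.update v j x ⟨2 * (i : ℕ) + 1, by omega⟩)
        (Function.update v j x ⟨2 * (i : ℕ) + 2, by omega⟩) = ∏ i ∈ Finset.univ.erase k,
        Ω (v ⟨2 * (i : ℕ) + 1, by omega⟩) (v ⟨2 * (i : ℕ) + 2, by omega⟩) := by
      refine Finset.prod_congr rfl fun i hi => ?_
      have hik : (i : ℕ) ≠ k := fun e => (Finset.mem_erase.1 hi).1 (Fin.ext e)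
      rw [hup _ (by simp; omega), hup _ (by simp; omega)]
    rw [this]
    ring
  rcases hk with hk | hk
  · refine ⟨c • Ω.flip (v ⟨2 * (k : ℕ) + 2, by omega⟩), fun x => ?_⟩
    rw [hc, hself _ hk.symm, hup _ (by simp; omega)]
    rfl
  · refine ⟨c • Ω (v ⟨2 * (k : ℕ) + 1, by omega⟩), fun x => ?_⟩
    rw [hc, hup _ (by simp; omega), hself _ hk.symm]
    rfl

/-- The multilinear form `θ ⊗ Ω ⊗ ⋯ ⊗ Ω`. -/
def tensorPower (n : ℕ) (Ω : V →ₗ[ℝ] V →ₗ[ℝ] ℝ) (θ : V →ₗ[ℝ] ℝ) :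
    MultilinearMap ℝ (fun _ : Fin (2 * n + 1) => V) ℝ where
  toFun v := θ (v 0) * ∏ i : Fin n,
    Ω (v ⟨2 * (i : ℕ) + 1, by omega⟩) (v ⟨2 * (i : ℕ) + 2, by omega⟩)
  map_update_add' v j x y := by
    obtain ⟨ℓ, hℓ⟩ := exists_linearMap_tensorPower_update n Ω θ v j
    rw [hℓ, hℓ, hℓ, map_add]
  map_update_smul' v j c x := by
    obtain ⟨ℓ, hℓ⟩ := exists_linearMap_tensorPower_update n Ω θ v j
    rw [hℓ, hℓ, map_smul]

lemma alternatization_tensorPower_apply (n : ℕ) (Ω : V →ₗ[ℝ] V →ₗ[ℝ] ℝ) (θ : V →ₗ[ℝ] ℝ)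
    (v : Fin (2 * n + 1) → V) :
    MultilinearMap.alternatization (tensorPower n Ω θ) v =
      ∑ σ : Equiv.Perm (Fin (2 * n + 1)), ((Equiv.Perm.sign σ : ℤ) : ℝ) *
        (θ (v (σ 0)) * ∏ i : Fin n,
          Ω (v (σ ⟨2 * (i : ℕ) + 1, by omega⟩)) (v (σ ⟨2 * (i : ℕ) + 2, by omega⟩))) := by
  rw [MultilinearMap.alternatization_apply]
  refine Finset.sum_congr rfl fun σ _ => ?_
  rw [Units.smul_def, zsmul_eq_mul]
  rfl

lemma tensorPower_eq_zero (n : ℕ) {Ω : V →ₗ[ℝ] V →ₗ[ℝ] ℝ} {θ : V →ₗ[ℝ] ℝ}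
    (hΩ : ∀ u v, Ω u v = -Ω v u) {a : V} (ha : θ a = 0) (ha' : Ω a = 0)
    (v : Fin (2 * n + 1) → V) (j : Fin (2 * n + 1)) (hj : v j = a) :
    tensorPower n Ω θ v = 0 := by
  change θ (v 0) * ∏ i : Fin n,
    Ω (v ⟨2 * (i : ℕ) + 1, by omega⟩) (v ⟨2 * (i : ℕ) + 2, by omega⟩) = 0
  rcases Nat.eq_zero_or_pos (j : ℕ) with h0 | h0
  · obtain rfl : j = 0 := Fin.ext h0
    rw [hj, ha, zero_mul]
  obtain ⟨k, hk⟩ : ∃ k : Fin n, (j : ℕ) = 2 * k + 1 ∨ (j : ℕ) = 2 * k + 2 :=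
    ⟨⟨((j : ℕ) - 1) / 2, by omega⟩, by simp only; omega⟩
  rw [Finset.prod_eq_zero (Finset.mem_univ k), mul_zero]
  rcases hk with hk | hk
  · have e : v ⟨2 * (k : ℕ) + 1, by omega⟩ = a := (congrArg v (Fin.ext hk.symm)).trans hj
    rw [e, ha', LinearMap.zero_apply]
  · have e : v ⟨2 * (k : ℕ) + 2, by omega⟩ = a := (congrArg v (Fin.ext hk.symm)).trans hj
    rw [e, hΩ, ha', LinearMap.zero_apply, neg_zero]

/-- If `θ ∧ Ωⁿ ≠ 0` on a space of dimension `2n + 1`, then `ker θ ∩ ker Ω = 0`. -/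
lemma eq_zero_of_alternatization_ne_zero [FiniteDimensional ℝ V] {n : ℕ}
    (hn : Module.finrank ℝ V = 2 * n + 1) {Ω : V →ₗ[ℝ] V →ₗ[ℝ] ℝ} {θ : V →ₗ[ℝ] ℝ}
    (hΩ : ∀ u v, Ω u v = -Ω v u) {v : Fin (2 * n + 1) → V}
    (hv : MultilinearMap.alternatization (tensorPower n Ω θ) v ≠ 0)
    {a : V} (ha : θ a = 0) (ha' : Ω a = 0) : a = 0 := by
  set A := MultilinearMap.alternatization (tensorPower n Ω θ) with hA
  have hli : LinearIndependent ℝ v := by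
    by_contra h
    exact hv (A.map_linearDependent v h)
  let b := basisOfLinearIndependentOfCardEqFinrank hli (by simp [hn])
  have hb : ⇑b = v := coe_basisOfLinearIndependentOfCardEqFinrank hli _
  -- Every permuted summand still has `a` in some slot, and the factor containing it vanishes.
  have hzero (j) : A (Function.update v j a) = 0 := by
    rw [hA, MultilinearMap.alternatization_apply]
    refine Finset.sum_eq_zero fun σ _ => ?_
    rw [MultilinearMap.domDomCongr_apply,
      tensorPower_eq_zero n hΩ ha ha' _ (σ.symm j) (by simp), smul_zero]
  refine b.ext_elem fun j => ?_
  -- Cramer's rule: expand `a` in the basis `v`. The terms with `i ≠ j` repeat a vector and vanish.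
  have h1 : A (Function.update v j a) = b.repr a j * A v := by
    have h2 := map_sum (A.toMultilinearMap.toLinearMap v j) (fun i => b.repr a i • v i) Finset.univ
    rw [← hb, b.sum_repr a, hb, Finset.sum_eq_single j] at h2
    · rw [LinearMap.map_smul] at h2
      simpa using h2
    · intro i _ hij
      rw [LinearMap.map_smul]
      have : A (Function.update v j (v i)) = 0 := A.map_update_self v hij.symm
      have h3 : (A.toMultilinearMap.toLinearMap v j) (v i) = 0 := this
      rw [h3, smul_zero]
    · simp
  rw [hzero] at h1
  simpa [hv] using h1.symm

/-- A skew matrix of odd size satisfies `det A = det Aᵀ = -det A`, so it is singular. Rescaling the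
kernel vector later supplies the Reeb vector. -/
lemma exists_ne_zero_of_skew_of_odd [FiniteDimensional ℝ V] {n : ℕ}
    (hn : Module.finrank ℝ V = 2 * n + 1) {Ω : V →ₗ[ℝ] V →ₗ[ℝ] ℝ}
    (hΩ : ∀ u v, Ω u v = -Ω v u) : ∃ r ≠ 0, Ω r = 0 := by
  let b := Module.finBasisOfFinrankEq ℝ V hn
  let A : Matrix (Fin (2 * n + 1)) (Fin (2 * n + 1)) ℝ := Matrix.of fun i j => Ω (b i) (b j)
  have hA : A.det = 0 := by
    have h1 : A.transpose = -A := by ext i j; exact hΩ _ _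
    have h2 : A.det = -A.det := by
      conv_lhs => rw [← Matrix.det_transpose, h1, Matrix.det_neg]
      simp [pow_succ, pow_mul]
    linarith
  obtain ⟨c, hc, hc'⟩ := Matrix.exists_vecMul_eq_zero_iff.2 hA
  refine ⟨∑ i, c i • b i, fun h => hc ?_, b.ext fun j => ?_⟩
  · ext i
    exact Fintype.linearIndependent_iff.1 b.linearIndependent c h i
  · have := congrFun hc' j
    simpa [Matrix.vecMul, dotProduct, A] using this

lemma IsContactPair.of_alternatization_ne_zero [FiniteDimensional ℝ V] [TopologicalSpace V]
    [IsTopologicalAddGroup V] [ContinuousSMul ℝ V] {n : ℕ}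
    (hn : Module.finrank ℝ V = 2 * n + 1) {Ω : V →L[ℝ] V →L[ℝ] ℝ} {θ : V →L[ℝ] ℝ}
    (hΩ : ∀ u v, Ω u v = -Ω v u)
    {v : Fin (2 * n + 1) → V}
    (hv : ∑ σ : Equiv.Perm (Fin (2 * n + 1)), ((Equiv.Perm.sign σ : ℤ) : ℝ) *
        (θ (v (σ 0)) * ∏ i : Fin n,
          Ω (v (σ ⟨2 * (i : ℕ) + 1, by omega⟩)) (v (σ ⟨2 * (i : ℕ) + 2, by omega⟩))) ≠ 0) :
    IsContactPair Ω θ := by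
  let Ω' : V →ₗ[ℝ] V →ₗ[ℝ] ℝ := ContinuousLinearMap.toLinearMap₁₂ Ω
  have hker (a : V) (h1 : θ a = 0) (h2 : Ω a = 0) : a = 0 := by
    refine eq_zero_of_alternatization_ne_zero hn (Ω := Ω') (θ := θ.toLinearMap) hΩ (v := v)
      ?_ h1 ?_
    · rw [alternatization_tensorPower_apply]
      exact hv
    · ext w
      exact DFunLike.congr_fun h2 w
  obtain ⟨r, hr, hr'⟩ := exists_ne_zero_of_skew_of_odd hn (Ω := Ω') hΩ
  have hr0 : Ω r = 0 := by
    ext w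
    exact DFunLike.congr_fun hr' w
  have hθ : θ r ≠ 0 := fun h => hr (hker r h hr0)
  exact ⟨hΩ, ⟨(θ r)⁻¹ • r, by simp [hr0], by simp [hθ]⟩, hker⟩

end Volume

/-! ### Naturality of the exterior derivative -/

section Pullback

variable {E F : Type*} [NormedAddCommGroup E] [NormedSpace ℝ E]
  [NormedAddCommGroup F] [NormedSpace ℝ F]

/-- The product rule adds a term with the second derivative of `G`, which cancels on
antisymmetrizing because that derivative is symmetric. -/
lemma fderiv_pullback_sub {α : F → F →L[ℝ] ℝ} {G : E → F} {y : E}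
    (hα : DifferentiableAt ℝ α (G y)) (hG : ContDiffAt ℝ 2 G y) (u v : E) :
    fderiv ℝ (fun z => (α (G z)).comp (fderiv ℝ G z)) y u v -
      fderiv ℝ (fun z => (α (G z)).comp (fderiv ℝ G z)) y v u =
    fderiv ℝ α (G y) (fderiv ℝ G y u) (fderiv ℝ G y v) -
      fderiv ℝ α (G y) (fderiv ℝ G y v) (fderiv ℝ G y u) := by
  have hG1 : HasFDerivAt G (fderiv ℝ G y) y := (hG.differentiableAt (by simp)).hasFDerivAt
  have hG2 : DifferentiableAt ℝ (fderiv ℝ G) y :=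
    (hG.fderiv_right (m := 1) (by norm_num)).differentiableAt (by simp)
  have hs : fderiv ℝ (fderiv ℝ G) y u v = fderiv ℝ (fderiv ℝ G) y v u :=
    (hG.isSymmSndFDerivAt (by simp)).eq u v
  have h := (hα.hasFDerivAt.comp y hG1).clm_comp hG2.hasFDerivAt
  have h' : fderiv ℝ (fun z => (α (G z)).comp (fderiv ℝ G z)) y = _ := h.fderiv
  rw [h']
  simp [hs]

end Pullback

section Manifold

variable {E H M : Type*} [NormedAddCommGroup E] [NormedSpace ℝ E] [TopologicalSpace H]
  {I : ModelWithCorners ℝ E H} [TopologicalSpace M] [ChartedSpace H M]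
  {E' H' M' : Type*} [NormedAddCommGroup E'] [NormedSpace ℝ E'] [TopologicalSpace H']
  {I' : ModelWithCorners ℝ E' H'} [TopologicalSpace M'] [ChartedSpace H' M']

lemma extD_apply (η : OneForm I M) (p : M) (u v : TangentSpace I p) :
    extD I η p u v =
      fderiv ℝ (OneForm.inChart I η p) (extChartAt I p p)
        (mfderiv I 𝓘(ℝ, E) (extChartAt I p) p u) (mfderiv I 𝓘(ℝ, E) (extChartAt I p) p v) -
      fderiv ℝ (OneForm.inChart I η p) (extChartAt I p p)
        (mfderiv I 𝓘(ℝ, E) (extChartAt I p) p v) (mfderiv I 𝓘(ℝ, E) (extChartAt I p) p u) :=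
  rfl

lemma extD_skew (η : OneForm I M) (p : M) (u v : TangentSpace I p) :
    extD I η p u v = -extD I η p v u := by
  rw [extD_apply, extD_apply]
  exact (neg_sub _ _).symm

/-- The pullback of a one-form. -/
def OneForm.pullback (I : ModelWithCorners ℝ E H) (α : OneForm I' M') (F : M → M') : OneForm I M :=
  fun q => (α (F q)).comp (mfderiv I I' F q)

lemma OneForm.apply_congr (α : OneForm I M) {q q' : M} (h : q = q') (w : E) :
    (show E →L[ℝ] ℝ from α q) w = (show E →L[ℝ] ℝ from α q') w := by
  rw [h]

variable [I.Boundaryless] [I'.Boundaryless] [IsManifold I 2 M] [IsManifold I' 2 M']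

/-- In charts, `F` becomes a map `G` of normed spaces. The chart expression of the pullback is the
pullback along `G` of the chart expression, at least near the base point, and this reduces the claim
to `fderiv_pullback_sub`. -/
lemma extD_pullback {F : M → M'} {p : M} (hF : ContMDiffAt I I' 2 F p) (α : OneForm I' M')
    (hα : DifferentiableAt ℝ (OneForm.inChart I' α (F p)) (extChartAt I' (F p) (F p)))
    (u v : TangentSpace I p) :
    extD I (OneForm.pullback I α F) p u v =
      extD I' α (F p) (mfderiv I I' F p u) (mfderiv I I' F p v) := by
  have : IsManifold I 1 M := .of_le (n := 2) (by norm_num)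
  have : IsManifold I' 1 M' := .of_le (n := 2) (by norm_num)
  set G : E → E' := fun y => extChartAt I' (F p) (F ((extChartAt I p).symm y)) with hGdef
  have hG : ContDiffAt ℝ 2 G (extChartAt I p p) := by
    have h := (contMDiffAt_iff.1 hF).2
    rw [I.range_eq_univ, contDiffWithinAt_univ] at h
    exact h
  have hGp : G (extChartAt I p p) = extChartAt I' (F p) (F p) := by
    rw [hGdef]; simp only [extChartAt_to_inv]
  have hsymm : ContinuousAt (extChartAt I p).symm (extChartAt I p p) :=
    continuousAt_extChartAt_symm p
  have htarget : ∀ᶠ y in 𝓝 (extChartAt I p p), y ∈ (extChartAt I p).target :=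
    extChartAt_target_mem_nhds p
  have hev : ∀ᶠ q in 𝓝 p, MDifferentiableAt I I' F q ∧ F q ∈ (extChartAt I' (F p)).source := by
    have h1 : ∀ᶠ q in 𝓝 p, ContMDiffAt I I' 2 F q := (contMDiffAt_iff_contMDiffAt_nhds (by simp)).1 hF
    have h2 : ∀ᶠ q in 𝓝 p, F q ∈ (extChartAt I' (F p)).source :=
      hF.continuousAt (extChartAt_source_mem_nhds (F p))
    filter_upwards [h1, h2] with q hq hq'
    exact ⟨hq.mdifferentiableAt (by simp), hq'⟩
  have hev' : ∀ᶠ y in 𝓝 (extChartAt I p p), y ∈ (extChartAt I p).target ∧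
      MDifferentiableAt I I' F ((extChartAt I p).symm y) ∧
      F ((extChartAt I p).symm y) ∈ (extChartAt I' (F p)).source := by
    refine htarget.and ?_
    have h1 : Filter.Tendsto (extChartAt I p).symm (𝓝 (extChartAt I p p)) (𝓝 p) := by
      have := hsymm.tendsto
      rwa [extChartAt_to_inv] at this
    exact h1.eventually hev
  have hsymm_diff {y : E} (hy : y ∈ (extChartAt I p).target) :
      MDifferentiableAt 𝓘(ℝ, E) I (extChartAt I p).symm y := by
    have h := mdifferentiableWithinAt_extChartAt_symm (I := I) hy
    rwa [I.range_eq_univ, mdifferentiableWithinAt_univ] at h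
  have hsymm_diff' {y : E'} (hy : y ∈ (extChartAt I' (F p)).target) :
      MDifferentiableAt 𝓘(ℝ, E') I' (extChartAt I' (F p)).symm y := by
    have h := mdifferentiableWithinAt_extChartAt_symm (I := I') hy
    rwa [I'.range_eq_univ, mdifferentiableWithinAt_univ] at h
  have hchart : OneForm.inChart I (OneForm.pullback I α F) p =ᶠ[𝓝 (extChartAt I p p)]
      fun z => (OneForm.inChart I' α (F p) (G z)).comp (fderiv ℝ G z) := by
    filter_upwards [hev'.eventually_nhds,
      (hG.eventually (by simp))] with y hy hGy
    have hy0 := hy.self_of_nhds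
    have hGd : MDifferentiableAt 𝓘(ℝ, E) 𝓘(ℝ, E') G y :=
      (hGy.differentiableAt (by simp)).mdifferentiableAt
    have hGt : G y ∈ (extChartAt I' (F p)).target := (extChartAt I' (F p)).map_source hy0.2.2
    -- Differentiating `F ∘ φ⁻¹ = φ'⁻¹ ∘ G` by the chain rule on both sides gives the required
    -- equality of pullbacks.
    have heq : (fun z => F ((extChartAt I p).symm z)) =ᶠ[𝓝 y]
        fun z => (extChartAt I' (F p)).symm (G z) := by
      filter_upwards [hy] with z hz
      exact ((extChartAt I' (F p)).left_inv hz.2.2).symm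
    have hd1 := mfderiv_comp y hy0.2.1 (hsymm_diff hy0.1)
    have hd2 := mfderiv_comp y (hsymm_diff' hGt) hGd
    have hd3 := heq.mfderiv_eq (I := 𝓘(ℝ, E)) (I' := I')
    ext w
    have e1 : mfderiv 𝓘(ℝ, E) I' (F ∘ (extChartAt I p).symm) y w =
        mfderiv 𝓘(ℝ, E) I' ((extChartAt I' (F p)).symm ∘ G) y w := DFunLike.congr_fun hd3 w
    rw [hd1, hd2] at e1
    have e2 : (show E →L[ℝ] E' from mfderiv 𝓘(ℝ, E) 𝓘(ℝ, E') G y) w = fderiv ℝ G y w := by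
      rw [mfderiv_eq_fderiv]
    have e3 := OneForm.apply_congr α heq.self_of_nhds
      (mfderiv I I' F ((extChartAt I p).symm y)
        (mfderiv 𝓘(ℝ, E) I (extChartAt I p).symm y w))
    refine e3.trans ?_
    refine congrArg (show E' →L[ℝ] ℝ from α ((extChartAt I' (F p)).symm (G y))) ?_
    refine e1.trans ?_
    exact congrArg (mfderiv 𝓘(ℝ, E') I' (extChartAt I' (F p)).symm (G y)) e2
  have hd (w : TangentSpace I p) : fderiv ℝ G (extChartAt I p p)
      (mfderiv I 𝓘(ℝ, E) (extChartAt I p) p w) =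
      mfderiv I' 𝓘(ℝ, E') (extChartAt I' (F p)) (F p) (mfderiv I I' F p w) := by
    have heq : (G ∘ extChartAt I p) =ᶠ[𝓝 p] (extChartAt I' (F p)) ∘ F := by
      filter_upwards [extChartAt_source_mem_nhds (I := I) p] with q hq
      simp only [Function.comp, hGdef, (extChartAt I p).left_inv hq]
    have hGd : MDifferentiableAt 𝓘(ℝ, E) 𝓘(ℝ, E') G (extChartAt I p p) :=
      (hG.differentiableAt (by simp)).mdifferentiableAt
    have hd1 := mfderiv_comp p hGd (mdifferentiableAt_extChartAt (I := I) (mem_chart_source H p))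
    have hd2 := mfderiv_comp p
      (mdifferentiableAt_extChartAt (I := I') (mem_chart_source H' (F p)))
      (hF.mdifferentiableAt (by simp))
    have hd3 := heq.mfderiv_eq (I := I) (I' := 𝓘(ℝ, E'))
    rw [hd1, hd2, mfderiv_eq_fderiv] at hd3
    exact DFunLike.congr_fun hd3 w
  have hα' : DifferentiableAt ℝ (OneForm.inChart I' α (F p)) (G (extChartAt I p p)) := by
    rwa [hGp]
  rw [extD_apply, hchart.fderiv_eq]
  refine (fderiv_pullback_sub hα' hG _ _).trans ?_
  rw [hd, hd, hGp, extD_apply]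

end Manifold

section ModelSpace

variable {E : Type*} [NormedAddCommGroup E] [NormedSpace ℝ E]

lemma inChart_modelSpace (β : OneForm 𝓘(ℝ, E) E) (x : E) :
    OneForm.inChart 𝓘(ℝ, E) β x = (show E → E →L[ℝ] ℝ from β) := by
  funext z
  have h : (extChartAt 𝓘(ℝ, E) x).symm = PartialEquiv.refl E := by
    rw [extChartAt_model_space_eq_id]; rfl
  ext w
  have h2 : mfderiv 𝓘(ℝ, E) 𝓘(ℝ, E) (PartialEquiv.refl E) z = ContinuousLinearMap.id ℝ E :=
    mfderiv_id
  change β ((extChartAt 𝓘(ℝ, E) x).symm z) (mfderiv 𝓘(ℝ, E) 𝓘(ℝ, E) (extChartAt 𝓘(ℝ, E) x).symm z w) = _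
  rw [h, h2]
  rfl

lemma extD_modelSpace (β : OneForm 𝓘(ℝ, E) E) (x u v : E) :
    extD 𝓘(ℝ, E) β x u v = fderiv ℝ (show E → E →L[ℝ] ℝ from β) x u v -
      fderiv ℝ (show E → E →L[ℝ] ℝ from β) x v u := by
  have h : mfderiv 𝓘(ℝ, E) 𝓘(ℝ, E) (extChartAt 𝓘(ℝ, E) x) x = ContinuousLinearMap.id ℝ E :=
    mfderiv_extChartAt_self
  refine (extD_apply β x u v).trans ?_
  rw [inChart_modelSpace, h, extChartAt_model_space_eq_id]
  rfl

end ModelSpace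

/-! ### Coordinate expressions of smooth one-forms -/

section Manifold

variable {E H M : Type*} [NormedAddCommGroup E] [NormedSpace ℝ E] [TopologicalSpace H]
  {I : ModelWithCorners ℝ E H} [TopologicalSpace M] [ChartedSpace H M] [I.Boundaryless]

lemma mdifferentiableAt_extChartAt_symm [IsManifold I 1 M] {p : M} {y : E}
    (hy : y ∈ (extChartAt I p).target) :
    MDifferentiableAt 𝓘(ℝ, E) I (extChartAt I p).symm y := by
  have h := mdifferentiableWithinAt_extChartAt_symm (I := I) hy
  rwa [I.range_eq_univ, mdifferentiableWithinAt_univ] at h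

lemma contMDiffAt_extChartAt_symm {n : ℕ∞ω} [IsManifold I n M] {p : M} {y : E}
    (hy : y ∈ (extChartAt I p).target) :
    ContMDiffAt 𝓘(ℝ, E) I n (extChartAt I p).symm y :=
  (contMDiffOn_extChartAt_symm p).contMDiffAt ((isOpen_extChartAt_target p).mem_nhds hy)

lemma mfderiv_symm_mfderiv_extChartAt [IsManifold I 1 M] {p q : M}
    (hq : q ∈ (extChartAt I p).source) (v : TangentSpace I q) :
    mfderiv 𝓘(ℝ, E) I (extChartAt I p).symm (extChartAt I p q)
      (mfderiv I 𝓘(ℝ, E) (extChartAt I p) q v) = v := by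
  have h := mfderivWithin_extChartAt_symm_comp_mfderiv_extChartAt' (I := I) hq
  rw [I.range_eq_univ, mfderivWithin_univ] at h
  exact DFunLike.congr_fun h v

/-- The inverse of the tangent trivialization is the derivative of the inverse chart, so the
coordinates of the section `η` in the dual trivialization are its chart expression. -/
lemma IsSmoothOneForm.contDiffOn_inChart [IsManifold I ∞ M] {η : OneForm I M}
    (hη : IsSmoothOneForm I η) (p : M) :
    ContDiffOn ℝ ∞ (OneForm.inChart I η p) (extChartAt I p).target := by
  intro y hy
  have hq : (extChartAt I p).symm y ∈ (extChartAt I p).source := (extChartAt I p).map_target hy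
  have hq' : (extChartAt I p).symm y ∈ (chartAt H p).source := by rwa [extChartAt_source] at hq
  have h1 := hη ((extChartAt I p).symm y)
  rw [(trivializationAt (E →L[ℝ] ℝ)
    (fun p : M => TangentSpace I p →L[ℝ] Bundle.Trivial M ℝ p) p).contMDiffAt_section_iff
      ⟨hq', trivial⟩] at h1
  have h2 := h1.comp y (contMDiffAt_extChartAt_symm (n := ∞) hy)
  rw [contMDiffAt_iff_contDiffAt] at h2
  refine (h2.congr_of_eventuallyEq ?_).contDiffWithinAt
  filter_upwards [(isOpen_extChartAt_target p).mem_nhds hy] with z hz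
  have hz' : (extChartAt I p).symm z ∈ (chartAt H p).source := by
    rw [← extChartAt_source I]; exact (extChartAt I p).map_target hz
  have h3 := TangentBundle.symmL_trivializationAt (𝕜 := ℝ) (I := I) hz'
  rw [(extChartAt I p).right_inv hz, I.range_eq_univ, mfderivWithin_univ] at h3
  ext w
  have h4 := DFunLike.congr_fun h3 w
  have h5 : (trivializationAt ℝ (Bundle.Trivial M ℝ) p).continuousLinearMapAt ℝ
      ((extChartAt I p).symm z) = ContinuousLinearMap.id ℝ ℝ :=
    Bundle.Trivial.continuousLinearMapAt_trivialization ℝ M ℝ _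
  refine (congrArg (η ((extChartAt I p).symm z)) h4.symm).trans ?_
  exact (DFunLike.congr_fun h5 _).symm

/-- `extD` uses the preferred chart of each point. Naturality under the inverse chart at `p` allows
this one chart to serve at all points of its domain. -/
lemma extD_mfderiv_symm [IsManifold I ∞ M] {η : OneForm I M} (hη : IsSmoothOneForm I η) {p : M}
    {y : E} (hy : y ∈ (extChartAt I p).target) (u v : E) :
    extD I η ((extChartAt I p).symm y) (mfderiv 𝓘(ℝ, E) I (extChartAt I p).symm y u)
      (mfderiv 𝓘(ℝ, E) I (extChartAt I p).symm y v) =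
      fderiv ℝ (OneForm.inChart I η p) y u v - fderiv ℝ (OneForm.inChart I η p) y v u := by
  have : IsManifold I 2 M := .of_le (n := ∞) (by norm_cast)
  exact (extD_pullback (contMDiffAt_extChartAt_symm (n := 2) hy) η
    (((hη.contDiffOn_inChart _).contDiffAt (extChartAt_target_mem_nhds _)).differentiableAt
      (by simp)) u v).symm.trans (extD_modelSpace _ y u v)

end Manifold

/-! ### The form `α^C + t α^V` in coordinates -/

section ModelSpace

variable {E : Type*} [NormedAddCommGroup E] [NormedSpace ℝ E]

/-- The exterior derivative of a one-form on a normed space, as a bilinear map. -/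
def curl (α : E → E →L[ℝ] ℝ) (y : E) : E →L[ℝ] E →L[ℝ] ℝ :=
  fderiv ℝ α y - (fderiv ℝ α y).flip

lemma curl_apply (α : E → E →L[ℝ] ℝ) (y u v : E) :
    curl α y u v = fderiv ℝ α y u v - fderiv ℝ α y v u := rfl

/-- The form `(y, w, t) ↦ α^C + t α^V` on `E × E × ℝ`. -/
def liftForm (α : E → E →L[ℝ] ℝ) (z : (E × E) × ℝ) : (E × E) × ℝ →L[ℝ] ℝ :=
  (fderiv ℝ α z.1.1 z.1.2 + z.2 • α z.1.1).comp
      ((ContinuousLinearMap.fst ℝ E E).comp (ContinuousLinearMap.fst ℝ (E × E) ℝ)) +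
    (α z.1.1).comp ((ContinuousLinearMap.snd ℝ E E).comp (ContinuousLinearMap.fst ℝ (E × E) ℝ))

lemma liftForm_apply (α : E → E →L[ℝ] ℝ) (z u : (E × E) × ℝ) :
    liftForm α z u = fderiv ℝ α z.1.1 z.1.2 u.1.1 + z.2 * α z.1.1 u.1.1 + α z.1.1 u.1.2 := rfl

variable {α : E → E →L[ℝ] ℝ} {z : (E × E) × ℝ}

lemma exists_hasFDerivAt_eval {F : Type*} [NormedAddCommGroup F] [NormedSpace ℝ F]
    {β : E → E →L[ℝ] F} {B : E →L[ℝ] E →L[ℝ] F} (hB : HasFDerivAt β B z.1.1) :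
    ∃ C : (E × E) × ℝ →L[ℝ] F, HasFDerivAt (fun z : (E × E) × ℝ => β z.1.1 z.1.2) C z ∧
      ∀ u, C u = B u.1.1 z.1.2 + β z.1.1 u.1.2 := by
  have hP : HasFDerivAt (fun z : (E × E) × ℝ => z.1.1)
      ((ContinuousLinearMap.fst ℝ E E).comp (ContinuousLinearMap.fst ℝ (E × E) ℝ)) z :=
    ((ContinuousLinearMap.fst ℝ E E).comp (ContinuousLinearMap.fst ℝ (E × E) ℝ)).hasFDerivAt
  have hQ : HasFDerivAt (fun z : (E × E) × ℝ => z.1.2)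
      ((ContinuousLinearMap.snd ℝ E E).comp (ContinuousLinearMap.fst ℝ (E × E) ℝ)) z :=
    ((ContinuousLinearMap.snd ℝ E E).comp (ContinuousLinearMap.fst ℝ (E × E) ℝ)).hasFDerivAt
  refine ⟨_, (HasFDerivAt.comp z (f := fun z : (E × E) × ℝ => z.1.1) hB hP).clm_apply hQ,
    fun u => ?_⟩
  simp
  abel

lemma exists_hasFDerivAt_liftForm (hα : ContDiffAt ℝ 2 α z.1.1) :
    ∃ A : (E × E) × ℝ →L[ℝ] (E × E) × ℝ →L[ℝ] ℝ, HasFDerivAt (liftForm α) A z ∧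
      ∀ u v, A u v = fderiv ℝ (fderiv ℝ α) z.1.1 u.1.1 z.1.2 v.1.1 +
        fderiv ℝ α z.1.1 u.1.2 v.1.1 + u.2 * α z.1.1 v.1.1 +
        z.2 * fderiv ℝ α z.1.1 u.1.1 v.1.1 + fderiv ℝ α z.1.1 u.1.1 v.1.2 := by
  let P := (ContinuousLinearMap.fst ℝ E E).comp (ContinuousLinearMap.fst ℝ (E × E) ℝ)
  let Q := (ContinuousLinearMap.snd ℝ E E).comp (ContinuousLinearMap.fst ℝ (E × E) ℝ)
  have hP : HasFDerivAt (fun z : (E × E) × ℝ => z.1.1) P z := P.hasFDerivAt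
  have hT : HasFDerivAt (fun z : (E × E) × ℝ => z.2) (ContinuousLinearMap.snd ℝ (E × E) ℝ) z :=
    (ContinuousLinearMap.snd ℝ (E × E) ℝ).hasFDerivAt
  have h1 : HasFDerivAt α (fderiv ℝ α z.1.1) z.1.1 := (hα.differentiableAt (by simp)).hasFDerivAt
  obtain ⟨C, hC, hC'⟩ := exists_hasFDerivAt_eval
    ((hα.fderiv_right (m := 1) (by norm_num)).differentiableAt (by simp)).hasFDerivAt
  have h1' : HasFDerivAt (fun z : (E × E) × ℝ => α z.1.1) _ z :=
    HasFDerivAt.comp z (f := fun z : (E × E) × ℝ => z.1.1) h1 hP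
  have h3 := (hC.add (hT.smul h1')).clm_comp (hasFDerivAt_const P z)
  have h4 := h1'.clm_comp (hasFDerivAt_const Q z)
  have h5 : HasFDerivAt (liftForm α) (fderiv ℝ (liftForm α) z) z :=
    (h3.add h4).differentiableAt.hasFDerivAt
  -- Only differentiability is taken from the product rule for operators. The formula comes from
  -- fixing `v` and differentiating the resulting scalar function.
  refine ⟨_, h5, fun u v => ?_⟩
  have h6 : HasFDerivAt (fun z => liftForm α z v) _ z := h5.clm_apply (hasFDerivAt_const v z)
  have h7 : HasFDerivAt (fun z => liftForm α z v) _ z :=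
    ((hC.clm_apply (hasFDerivAt_const v.1.1 z)).add
      (hT.mul (h1'.clm_apply (hasFDerivAt_const v.1.1 z)))).add
      (h1'.clm_apply (hasFDerivAt_const v.1.2 z))
  have h8 := DFunLike.congr_fun (h6.unique h7) u
  simp [P, hC'] at h8
  rw [h8]
  ring

/-- The second derivatives of `α` are collected in `S`. Nondegeneracy only uses that `S` vanishes
when either argument is zero. -/
lemma exists_curl_liftForm_eq (hα : ContDiffAt ℝ 2 α z.1.1) :
    ∃ S : E → E → ℝ, (∀ v, S 0 v = 0) ∧ (∀ v, S v 0 = 0) ∧ ∀ u v,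
      curl (liftForm α) z u v = S u.1.1 v.1.1 +
      curl α z.1.1 u.1.2 v.1.1 + curl α z.1.1 u.1.1 v.1.2 + z.2 * curl α z.1.1 u.1.1 v.1.1 +
      (u.2 * α z.1.1 v.1.1 - v.2 * α z.1.1 u.1.1) := by
  obtain ⟨A, hA, hA'⟩ := exists_hasFDerivAt_liftForm hα
  refine ⟨fun u v => fderiv ℝ (fderiv ℝ α) z.1.1 u z.1.2 v - fderiv ℝ (fderiv ℝ α) z.1.1 v z.1.2 u,
    fun v => ?_, fun v => ?_, fun u v => ?_⟩
  · beta_reduce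
    rw [ContinuousLinearMap.map_zero, ContinuousLinearMap.map_zero]
    simp
  · beta_reduce
    rw [ContinuousLinearMap.map_zero, ContinuousLinearMap.map_zero]
    simp
  · rw [curl_apply, hA.fderiv, hA', hA', curl_apply, curl_apply, curl_apply]
    ring

/-- The Reeb vector is the vertical lift `((0, r), 0)`. Nondegeneracy is triangular: suitable test
vectors eliminate the base component, then the `ℝ` component, then the fibre component. -/
lemma IsContactPair.liftForm (hα : ContDiffAt ℝ 2 α z.1.1)
    (h : IsContactPair (curl α z.1.1) (α z.1.1)) :
    IsContactPair (curl (liftForm α) z) (ContactGeometry.liftForm α z) := by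
  obtain ⟨r, hr, hr'⟩ := h.exists_reeb
  obtain ⟨S, hS, hS', hcurl⟩ := exists_curl_liftForm_eq hα
  have hr2 (v : E) : curl α z.1.1 v r = 0 := by rw [h.skew, hr]; simp
  refine ⟨fun u v => by rw [curl_apply, curl_apply]; ring, ⟨((0, r), 0), ?_, ?_⟩, ?_⟩
  · refine ContinuousLinearMap.ext fun v => ?_
    rw [hcurl]
    simp [hr, hS]
  · rw [liftForm_apply]
    simp [hr']
  · rintro ⟨⟨a, b⟩, c⟩ h1 h2
    have h3 (v : (E × E) × ℝ) := DFunLike.congr_fun h2 v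
    simp only [hcurl, zero_apply] at h3
    -- Testing against `∂_t` gives `α(a) = 0`; testing against vertical vectors gives `i_a dα = 0`.
    have ha : a = 0 := by
      refine h.eq_zero a ?_ ?_
      · simpa [hS'] using h3 ((0, 0), 1)
      · refine ContinuousLinearMap.ext fun v => ?_
        simpa [hS'] using h3 ((0, v), 0)
    subst ha
    -- Against the horizontal Reeb vector only `c * α(r) = c` survives.
    have hc : c = 0 := by simpa [hr2, hr', hS] using h3 ((r, 0), 0)
    subst hc
    have hb : b = 0 := by
      refine h.eq_zero b ?_ ?_
      · simpa [liftForm_apply] using h1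
      · refine ContinuousLinearMap.ext fun v => ?_
        simpa [hS] using h3 ((v, 0), 0)
    rw [hb]
    rfl

end ModelSpace

/-! ### Charts of the tangent bundle and evaluation of `η^C + t η^V` -/

section Manifold

set_option linter.unusedSectionVars false

variable {E H M : Type*} [NormedAddCommGroup E] [NormedSpace ℝ E] [TopologicalSpace H]
  {I : ModelWithCorners ℝ E H} [TopologicalSpace M] [ChartedSpace H M]

lemma extD_eq_curl [IsManifold I 1 M] (η : OneForm I M) (p : M) :
    (show E →L[ℝ] E →L[ℝ] ℝ from extD I η p) =
      curl (OneForm.inChart I η p) (extChartAt I p p) := by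
  have h : (show E →L[ℝ] E from mfderiv I 𝓘(ℝ, E) (extChartAt I p) p) = .id ℝ E :=
    mfderiv_extChartAt_self
  ext u v
  have h' (u : E) : (show E →L[ℝ] E from mfderiv I 𝓘(ℝ, E) (extChartAt I p) p) u = u := by
    rw [h]; rfl
  refine (extD_apply η p u v).trans ?_
  exact congrArg₂ (fun a b => fderiv ℝ (OneForm.inChart I η p) (extChartAt I p p) a b -
    fderiv ℝ (OneForm.inChart I η p) (extChartAt I p p) b a) (h' u) (h' v)

variable [I.Boundaryless]

lemma inChart_self [IsManifold I 1 M] (η : OneForm I M) (p : M) :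
    OneForm.inChart I η p (extChartAt I p p) = (show E →L[ℝ] ℝ from η p) := by
  have h : (show E →L[ℝ] E from mfderiv 𝓘(ℝ, E) I (extChartAt I p).symm (extChartAt I p p)) =
      .id ℝ E := by
    have := mfderivWithin_range_extChartAt_symm (I := I) (x := p)
    rwa [I.range_eq_univ, mfderivWithin_univ] at this
  ext w
  have h' : (show E →L[ℝ] E from mfderiv 𝓘(ℝ, E) I (extChartAt I p).symm (extChartAt I p p)) w = w := by
    rw [h]; rfl
  refine (OneForm.apply_congr η (extChartAt_to_inv p) _).trans ?_
  exact congrArg (η p) h'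

/-- At its own centre the preferred chart has identity derivative, so both sides concern the same
pair of forms on `E`. -/
lemma isContactPair_iff_inChart [IsManifold I 1 M] (η : OneForm I M) (p : M) :
    IsContactPair (extD I η p) (η p) ↔ IsContactPair (curl (OneForm.inChart I η p)
      (extChartAt I p p)) (OneForm.inChart I η p (extChartAt I p p)) := by
  rw [← extD_eq_curl, inChart_self]
  rfl

lemma IsContactForm.finiteDimensional [IsManifold I 1 M] {n : ℕ} {η : OneForm I M}
    (hη : IsContactForm I n η) : FiniteDimensional ℝ E :=
  Module.finite_of_finrank_pos (lt_of_lt_of_eq (Nat.succ_pos _) hη.finrank_eq.symm)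

lemma IsContactForm.isContactPair [IsManifold I 1 M] {n : ℕ} {η : OneForm I M}
    (hη : IsContactForm I n η) (p : M) : IsContactPair (extD I η p) (η p) := by
  obtain ⟨v, hv⟩ := hη.nonvanishing p
  have : FiniteDimensional ℝ (TangentSpace I p) := hη.finiteDimensional
  exact IsContactPair.of_alternatization_ne_zero (V := TangentSpace I p)
    (show Module.finrank ℝ (TangentSpace I p) = 2 * n + 1 from hη.finrank_eq) (extD_skew η p)
    (right_ne_zero_of_mul hv)

lemma contMDiff_pairing [IsManifold I ∞ M] {η : OneForm I M} (hη : IsSmoothOneForm I η) :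
    ContMDiff I.tangent 𝓘(ℝ, ℝ) ∞ (fun w : TangentBundle I M => η w.proj w.snd) := by
  intro w
  have h1 : ContMDiff I.tangent I ∞ (fun w : TangentBundle I M => w.proj) :=
    contMDiff_proj (TangentSpace I)
  have h2 := ContMDiff.clm_bundle_apply (E₁ := (TangentSpace I : M → Type _))
    (E₂ := Bundle.Trivial M ℝ) (b := fun w : TangentBundle I M => w.proj)
    (ϕ := fun w : TangentBundle I M => η w.proj) (hη.comp h1) (v := fun w : TangentBundle I M => w.snd) contMDiff_id
  exact (contMDiffAt_totalSpace.1 (h2 w)).2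

section

variable {E' H' N : Type*} [NormedAddCommGroup E'] [NormedSpace ℝ E'] [TopologicalSpace H']
  {J : ModelWithCorners ℝ E' H'} [TopologicalSpace N] [ChartedSpace H' N]

/-- Chain rule for an arbitrary map into `TM × ℝ`. It is applied both to the inverse chart of `TM ×
ℝ`, for the coordinate formula, and to `X × f`, for the main identity. -/
lemma contactification_mfderiv [IsManifold I ∞ M] {η : OneForm I M} (hη : IsSmoothOneForm I η)
    (b : N → M) (v : (z : N) → TangentSpace I (b z)) (t : N → ℝ) {z : N}
    (hG : MDifferentiableAt J (I.tangent.prod 𝓘(ℝ, ℝ))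
      (fun z => ((⟨b z, v z⟩ : TangentBundle I M), t z)) z) (u : TangentSpace J z) :
    contactification I η (⟨b z, v z⟩, t z) (mfderiv J (I.tangent.prod 𝓘(ℝ, ℝ))
      (fun z => ((⟨b z, v z⟩ : TangentBundle I M), t z)) z u) =
      diff J (fun z => η (b z) (v z)) z u +
        extD I η (b z) (v z) (mfderiv J I b z u) + t z * η (b z) (mfderiv J I b z u) := by
  have h1 : mfderiv J I.tangent (fun z => (⟨b z, v z⟩ : TangentBundle I M)) z u =
      mfderiv (I.tangent.prod 𝓘(ℝ, ℝ)) I.tangent (fun r : TangentBundle I M × ℝ => r.1)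
        (⟨b z, v z⟩, t z) (mfderiv J (I.tangent.prod 𝓘(ℝ, ℝ))
      (fun z => ((⟨b z, v z⟩ : TangentBundle I M), t z)) z u) :=
    DFunLike.congr_fun (mfderiv_comp z (g := fun r : TangentBundle I M × ℝ => r.1)
      mdifferentiableAt_fst hG) u
  have hb : MDifferentiableAt J I.tangent (fun z => (⟨b z, v z⟩ : TangentBundle I M)) z :=
    mdifferentiableAt_fst.comp z hG
  have h2 : mfderiv J I b z u = mfderiv I.tangent I (fun w : TangentBundle I M => w.proj)
      ⟨b z, v z⟩ (mfderiv J I.tangent (fun z => (⟨b z, v z⟩ : TangentBundle I M)) z u) :=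
    DFunLike.congr_fun (mfderiv_comp z (g := fun w : TangentBundle I M => w.proj)
      (mdifferentiableAt_proj (TangentSpace I)) hb) u
  have h3 : diff J (fun z => η (b z) (v z)) z u =
      diff I.tangent (fun w : TangentBundle I M => η w.proj w.snd)
      ⟨b z, v z⟩ (mfderiv J I.tangent (fun z => (⟨b z, v z⟩ : TangentBundle I M)) z u) :=
    DFunLike.congr_fun (mfderiv_comp z (g := fun w : TangentBundle I M => η w.proj w.snd)
      ((contMDiff_pairing hη _).mdifferentiableAt (by simp)) hb) u
  rw [h3, h2, h1]
  rfl

end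

lemma tangentBundle_extChartAt_symm [IsManifold I 1 M] (v : TangentBundle I M) {y : E}
    (hy : y ∈ (extChartAt I v.proj).target) (w : E) :
    (extChartAt I.tangent v).symm (y, w) =
      ⟨(extChartAt I v.proj).symm y, mfderiv 𝓘(ℝ, E) I (extChartAt I v.proj).symm y w⟩ := by
  have hz' : (extChartAt I v.proj).symm y ∈ (chartAt H v.proj).source := by
    rw [← extChartAt_source I]; exact (extChartAt I v.proj).map_target hy
  have h3 := TangentBundle.symmL_trivializationAt (𝕜 := ℝ) (I := I) hz'
  rw [(extChartAt I v.proj).right_inv hy, I.range_eq_univ, mfderivWithin_univ] at h3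
  have h4 : (extChartAt I.tangent v).symm (y, w) =
      (trivializationAt E (TangentSpace I) v.proj).toOpenPartialHomeomorph.symm
        ((extChartAt I v.proj).symm y, w) := by
    rw [FiberBundle.extChartAt]
    rfl
  have h5 := (trivializationAt E (TangentSpace I) v.proj).mk_symm (b := (extChartAt I v.proj).symm y)
    hz' w
  rw [h4, ← h5]
  have h6 : (trivializationAt E (TangentSpace I) v.proj).symm ((extChartAt I v.proj).symm y) w =
    mfderiv 𝓘(ℝ, E) I (extChartAt I v.proj).symm y w :=
    ((trivializationAt E (TangentSpace I) v.proj).symmL_apply hz' w).symm.trans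
      (DFunLike.congr_fun h3 w)
  rw [h6]

end Manifold

/-! ### `η^C + t η^V` is contact at every point -/

section Manifold

set_option linter.unusedSectionVars false

variable {E H M : Type*} [NormedAddCommGroup E] [NormedSpace ℝ E] [TopologicalSpace H]
  {I : ModelWithCorners ℝ E H} [TopologicalSpace M] [ChartedSpace H M] [I.Boundaryless]
  [IsManifold I ∞ M]

lemma mem_extChartAt_tangentBundle_prod_target (x : TangentBundle I M × ℝ) {z : (E × E) × ℝ}
    (hz : z.1.1 ∈ (extChartAt I x.1.proj).target) :
    z ∈ (extChartAt (I.tangent.prod 𝓘(ℝ, ℝ)) x).target := by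
  rw [extChartAt_prod, PartialEquiv.prod_target, FiberBundle.extChartAt_target]
  refine ⟨⟨⟨hz, ?_⟩, trivial⟩, ?_⟩
  · have := (extChartAt I x.1.proj).map_target hz
    rwa [extChartAt_source] at this
  · rw [extChartAt_model_space_eq_id]
    trivial

lemma tangentBundle_prod_extChartAt_symm (x : TangentBundle I M × ℝ) {z : (E × E) × ℝ}
    (hz : z.1.1 ∈ (extChartAt I x.1.proj).target) :
    (extChartAt (I.tangent.prod 𝓘(ℝ, ℝ)) x).symm z =
      (⟨(extChartAt I x.1.proj).symm z.1.1,
        mfderiv 𝓘(ℝ, E) I (extChartAt I x.1.proj).symm z.1.1 z.1.2⟩, z.2) := by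
  rw [← tangentBundle_extChartAt_symm x.1 hz z.1.2, extChartAt_prod,
    extChartAt_model_space_eq_id]
  rfl

/-- The inverse chart is `(y, w, t) ↦ (dφ⁻¹_y(w), t)`. Along it the pairing becomes `α_y(w)`, and
`dη` becomes the antisymmetrized derivative of `α`. Adding them cancels one derivative term and
leaves `liftForm`. -/
lemma inChart_contactification {η : OneForm I M} (hη : IsSmoothOneForm I η)
    (x : TangentBundle I M × ℝ) {z : (E × E) × ℝ}
    (hz : z.1.1 ∈ (extChartAt I x.1.proj).target) :
    OneForm.inChart (I.tangent.prod 𝓘(ℝ, ℝ)) (contactification I η) x z =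
      liftForm (OneForm.inChart I η x.1.proj) z := by
  let ψ : (E × E) × ℝ → TangentBundle I M × ℝ := (extChartAt (I.tangent.prod 𝓘(ℝ, ℝ)) x).symm
  let b : (E × E) × ℝ → M := fun z => (extChartAt I x.1.proj).symm z.1.1
  let v : (z : (E × E) × ℝ) → TangentSpace I (b z) := fun z =>
    mfderiv 𝓘(ℝ, E) I (extChartAt I x.1.proj).symm z.1.1 z.1.2
  let G : (E × E) × ℝ → TangentBundle I M × ℝ := fun z => (⟨b z, v z⟩, z.2)
  have heq : ψ =ᶠ[𝓝 z] G := by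
    have : Continuous fun z : (E × E) × ℝ => z.1.1 := by fun_prop
    filter_upwards [this.continuousAt.preimage_mem_nhds
      ((isOpen_extChartAt_target x.1.proj).mem_nhds hz)] with z' hz'
    exact tangentBundle_prod_extChartAt_symm x hz'
  have hψ : MDifferentiableAt 𝓘(ℝ, (E × E) × ℝ) (I.tangent.prod 𝓘(ℝ, ℝ)) ψ z := by
    have : IsManifold (I.tangent.prod 𝓘(ℝ, ℝ)) 1 (TangentBundle I M × ℝ) := .of_le (n := ∞) (by norm_cast)
    exact mdifferentiableAt_extChartAt_symm (mem_extChartAt_tangentBundle_prod_target x hz)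
  have hG : MDifferentiableAt 𝓘(ℝ, (E × E) × ℝ) (I.tangent.prod 𝓘(ℝ, ℝ)) G z :=
    hψ.congr_of_eventuallyEq heq.symm
  have hηz : HasFDerivAt (OneForm.inChart I η x.1.proj)
      (fderiv ℝ (OneForm.inChart I η x.1.proj) z.1.1) z.1.1 :=
    (((hη.contDiffOn_inChart _).contDiffAt
      ((isOpen_extChartAt_target x.1.proj).mem_nhds hz)).differentiableAt (by simp)).hasFDerivAt
  obtain ⟨C, hC, hC'⟩ := exists_hasFDerivAt_eval hηz
  refine ContinuousLinearMap.ext fun u => ?_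
  have h1 : OneForm.inChart (I.tangent.prod 𝓘(ℝ, ℝ)) (contactification I η) x z u =
      contactification I η (G z)
        (mfderiv 𝓘(ℝ, (E × E) × ℝ) (I.tangent.prod 𝓘(ℝ, ℝ)) G z u) := by
    refine (OneForm.apply_congr (contactification I η) heq.self_of_nhds _).trans ?_
    exact congrArg (contactification I η (G z))
      (DFunLike.congr_fun (heq.mfderiv_eq (I := 𝓘(ℝ, (E × E) × ℝ))
        (I' := I.tangent.prod 𝓘(ℝ, ℝ))) u)
  have h2 : diff 𝓘(ℝ, (E × E) × ℝ) (fun z => η (b z) (v z)) z u =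
      fderiv ℝ (OneForm.inChart I η x.1.proj) z.1.1 u.1.1 z.1.2 +
        OneForm.inChart I η x.1.proj z.1.1 u.1.2 := by
    rw [← hC' u, ← hC.fderiv]
    exact DFunLike.congr_fun mfderiv_eq_fderiv u
  have h3 : mfderiv 𝓘(ℝ, (E × E) × ℝ) I b z u =
      mfderiv 𝓘(ℝ, E) I (extChartAt I x.1.proj).symm z.1.1 u.1.1 := by
    have : IsManifold I 1 M := .of_le (n := ∞) (by norm_cast)
    have hP : HasFDerivAt (fun z : (E × E) × ℝ => z.1.1)
        ((ContinuousLinearMap.fst ℝ E E).comp (ContinuousLinearMap.fst ℝ (E × E) ℝ)) z :=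
      ((ContinuousLinearMap.fst ℝ E E).comp (ContinuousLinearMap.fst ℝ (E × E) ℝ)).hasFDerivAt
    have h4 := (mdifferentiableAt_extChartAt_symm (I := I) hz).hasMFDerivAt.comp z
      (f := fun z : (E × E) × ℝ => z.1.1) hP.hasMFDerivAt
    exact DFunLike.congr_fun h4.mfderiv u
  refine h1.trans ((contactification_mfderiv hη b v (fun z => z.2) hG u).trans ?_)
  rw [h2, h3, extD_mfderiv_symm hη hz, liftForm_apply]
  change _ + z.2 * (OneForm.inChart I η x.1.proj z.1.1 u.1.1) = _
  ring

lemma inChart_contactification_eventuallyEq {η : OneForm I M} (hη : IsSmoothOneForm I η)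
    (x : TangentBundle I M × ℝ) :
    OneForm.inChart (I.tangent.prod 𝓘(ℝ, ℝ)) (contactification I η) x
      =ᶠ[𝓝 (extChartAt (I.tangent.prod 𝓘(ℝ, ℝ)) x x)] liftForm (OneForm.inChart I η x.1.proj) := by
  have hc : Continuous fun z : (E × E) × ℝ => z.1.1 := by fun_prop
  have hx : (extChartAt (I.tangent.prod 𝓘(ℝ, ℝ)) x x).1.1 ∈ (extChartAt I x.1.proj).target :=
    mem_extChartAt_target x.1.proj
  filter_upwards [hc.continuousAt.preimage_mem_nhds
    ((isOpen_extChartAt_target x.1.proj).mem_nhds hx)] with z hz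
  exact inChart_contactification hη x hz

lemma contDiffAt_inChart_fst {η : OneForm I M} (hη : IsSmoothOneForm I η)
    (x : TangentBundle I M × ℝ) :
    ContDiffAt ℝ 2 (OneForm.inChart I η x.1.proj)
      (extChartAt (I.tangent.prod 𝓘(ℝ, ℝ)) x x).1.1 :=
  ((hη.contDiffOn_inChart x.1.proj).contDiffAt (extChartAt_target_mem_nhds x.1.proj)).of_le
    (by norm_cast)

lemma differentiableAt_inChart_contactification {η : OneForm I M} (hη : IsSmoothOneForm I η)
    (x : TangentBundle I M × ℝ) :
    DifferentiableAt ℝ (OneForm.inChart (I.tangent.prod 𝓘(ℝ, ℝ)) (contactification I η) x)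
      (extChartAt (I.tangent.prod 𝓘(ℝ, ℝ)) x x) := by
  obtain ⟨A, hA, -⟩ := exists_hasFDerivAt_liftForm (contDiffAt_inChart_fst hη x)
  exact hA.differentiableAt.congr_of_eventuallyEq (inChart_contactification_eventuallyEq hη x)

/-- `η^C + t η^V` is a contact form on `TM × ℝ`, pointwise. -/
lemma isContactPair_contactification {η : OneForm I M} (hη : IsSmoothOneForm I η)
    (x : TangentBundle I M × ℝ) (h : IsContactPair (extD I η x.1.proj) (η x.1.proj)) :
    IsContactPair (extD (I.tangent.prod 𝓘(ℝ, ℝ)) (contactification I η) x)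
      (contactification I η x) := by
  have : IsManifold I 1 M := .of_le (n := ∞) (by norm_cast)
  have : IsManifold (I.tangent.prod 𝓘(ℝ, ℝ)) 1 (TangentBundle I M × ℝ) :=
    .of_le (n := ∞) (by norm_cast)
  rw [isContactPair_iff_inChart] at h ⊢
  have he := inChart_contactification_eventuallyEq hη x
  have h1 := IsContactPair.liftForm (contDiffAt_inChart_fst hη x) h
  rw [he.self_of_nhds]
  rw [curl, he.fderiv_eq]
  exact h1

lemma extD_zero {E' H' N : Type*} [NormedAddCommGroup E'] [NormedSpace ℝ E'] [TopologicalSpace H']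
    {J : ModelWithCorners ℝ E' H'} [TopologicalSpace N] [ChartedSpace H' N] {α : OneForm J N}
    (hα : ∀ q, α q = 0) (q : N) (u v : TangentSpace J q) : extD J α q u v = 0 := by
  have h : OneForm.inChart J α q = fun _ => 0 := by
    funext y
    rw [OneForm.inChart, hα]
    rfl
  have h' : fderiv ℝ (fun _ : E' => (0 : E' →L[ℝ] ℝ)) (extChartAt J q q) = 0 := by simp
  rw [extD_apply, h, h']
  exact sub_self (0 : ℝ)

/-! ### The pullback along `X × f` -/

section Graph

variable {X : VField I M} {f : M → ℝ}

lemma contMDiff_vfieldProd (hX : IsSmoothVField I X) (hf : ContMDiff I 𝓘(ℝ, ℝ) ∞ f) :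
    ContMDiff I (I.tangent.prod 𝓘(ℝ, ℝ)) ∞ (vfieldProd I X f) :=
  hX.prodMk hf

lemma contactification_mfderiv_vfieldProd {η : OneForm I M} (hη : IsSmoothOneForm I η)
    (hX : IsSmoothVField I X) (hf : ContMDiff I 𝓘(ℝ, ℝ) ∞ f) (p : M) (u : TangentSpace I p) :
    contactification I η (vfieldProd I X f p)
      (mfderiv I (I.tangent.prod 𝓘(ℝ, ℝ)) (vfieldProd I X f) p u) =
      lieDeriv I X η p u + f p * η p u := by
  refine (contactification_mfderiv hη (fun q => q) X f
    ((contMDiff_vfieldProd hX hf p).mdifferentiableAt (by simp)) u).trans ?_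
  have h : mfderiv I I (fun q : M => q) p = ContinuousLinearMap.id ℝ (TangentSpace I p) := mfderiv_id
  rw [h, lieDeriv]
  change _ = extD I η p (X p) u + diff I (fun q => η q (X q)) p u + f p * η p u
  rw [add_comm (extD I η p (X p) u)]
  rfl

lemma isInfConformalContacto_iff {η : OneForm I M} (hη : IsSmoothOneForm I η)
    (hX : IsSmoothVField I X) (hf : ContMDiff I 𝓘(ℝ, ℝ) ∞ f) :
    IsInfConformalContacto I η (fun p => -f p) X ↔ ∀ p u,
      contactification I η (vfieldProd I X f p)
        (mfderiv I (I.tangent.prod 𝓘(ℝ, ℝ)) (vfieldProd I X f) p u) = 0 := by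
  refine forall_congr' fun p => ?_
  rw [ContinuousLinearMap.ext_iff]
  refine forall_congr' fun u => ?_
  rw [contactification_mfderiv_vfieldProd hη hX hf]
  change lieDeriv I X η p u = -f p * η p u ↔ _
  constructor <;> intro h <;> linarith

/-- By naturality this is `d` of the pullback of `η̄`, a form that is identically zero. -/
lemma extD_contactification_mfderiv {η : OneForm I M} (hη : IsSmoothOneForm I η)
    (hX : IsSmoothVField I X) (hf : ContMDiff I 𝓘(ℝ, ℝ) ∞ f)
    (h : ∀ p u, contactification I η (vfieldProd I X f p)
        (mfderiv I (I.tangent.prod 𝓘(ℝ, ℝ)) (vfieldProd I X f) p u) = 0)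
    (p : M) (u v : TangentSpace I p) :
    extD (I.tangent.prod 𝓘(ℝ, ℝ)) (contactification I η) (vfieldProd I X f p)
      (mfderiv I (I.tangent.prod 𝓘(ℝ, ℝ)) (vfieldProd I X f) p u)
      (mfderiv I (I.tangent.prod 𝓘(ℝ, ℝ)) (vfieldProd I X f) p v) = 0 := by
  have : IsManifold I 2 M := .of_le (n := ∞) (by norm_cast)
  have : IsManifold (I.tangent.prod 𝓘(ℝ, ℝ)) 2 (TangentBundle I M × ℝ) :=
    .of_le (n := ∞) (by norm_cast)
  rw [← extD_pullback ((contMDiff_vfieldProd hX hf p).of_le (by norm_cast))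
    (contactification I η) (differentiableAt_inChart_contactification hη _)]
  exact extD_zero (fun q => ContinuousLinearMap.ext (h q)) p u v

lemma mfderiv_proj_mfderiv_vfieldProd (hX : IsSmoothVField I X) (hf : ContMDiff I 𝓘(ℝ, ℝ) ∞ f)
    (p : M) (u : TangentSpace I p) :
    mfderiv (I.tangent.prod 𝓘(ℝ, ℝ)) I (fun x : TangentBundle I M × ℝ => x.1.proj)
      (vfieldProd I X f p) (mfderiv I (I.tangent.prod 𝓘(ℝ, ℝ)) (vfieldProd I X f) p u) = u := by
  have h1 : MDifferentiableAt (I.tangent.prod 𝓘(ℝ, ℝ)) I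
      (fun x : TangentBundle I M × ℝ => x.1.proj) (vfieldProd I X f p) :=
    (mdifferentiableAt_proj (TangentSpace I)).comp _ mdifferentiableAt_fst
  have h2 := mfderiv_comp p h1 ((contMDiff_vfieldProd hX hf p).mdifferentiableAt (by simp))
  have h3 : mfderiv I I (fun q : M => q) p = ContinuousLinearMap.id ℝ (TangentSpace I p) := mfderiv_id
  exact (DFunLike.congr_fun h2 u).symm.trans (DFunLike.congr_fun h3 u)

lemma mfderiv_vfieldProd_injective (hX : IsSmoothVField I X) (hf : ContMDiff I 𝓘(ℝ, ℝ) ∞ f)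
    (p : M) : Function.Injective (mfderiv I (I.tangent.prod 𝓘(ℝ, ℝ)) (vfieldProd I X f) p) :=
  Function.LeftInverse.injective (mfderiv_proj_mfderiv_vfieldProd hX hf p)

end Graph

end Manifold

/-! ### Tangent spaces of images through velocities of curves -/

section TangentVectors

variable {E H M : Type*} [NormedAddCommGroup E] [NormedSpace ℝ E] [TopologicalSpace H]
  {I : ModelWithCorners ℝ E H} [TopologicalSpace M] [ChartedSpace H M] [I.Boundaryless]
  [IsManifold I ∞ M]
  {E' H' N : Type*} [NormedAddCommGroup E'] [NormedSpace ℝ E'] [TopologicalSpace H']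
  {J : ModelWithCorners ℝ E' H'} [TopologicalSpace N] [ChartedSpace H' N]

/-- Every tangent vector is the velocity of a curve. -/
lemma exists_curve (p : M) (u : TangentSpace I p) :
    ∃ γ : ℝ → M, γ 0 = p ∧ ∃ ε > 0, ContMDiffOn 𝓘(ℝ, ℝ) I ∞ γ (Set.Ioo (-ε) ε) ∧
      mfderiv 𝓘(ℝ, ℝ) I γ 0 (1 : ℝ) = u := by
  have : IsManifold I 1 M := .of_le (n := ∞) (by norm_cast)
  let w : E := mfderiv I 𝓘(ℝ, E) (extChartAt I p) p u
  let c : ℝ → E := fun s => extChartAt I p p + s • w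
  have hc : ContDiff ℝ ∞ c := by fun_prop
  have hc0 : c 0 = extChartAt I p p := by simp [c]
  have hd : HasDerivAt c w 0 := by
    simpa [c] using ((hasDerivAt_id (0 : ℝ)).smul_const w).const_add (extChartAt I p p)
  have hnhds : c ⁻¹' (extChartAt I p).target ∈ 𝓝 (0 : ℝ) :=
    hc.continuous.continuousAt.preimage_mem_nhds (hc0 ▸ extChartAt_target_mem_nhds p)
  obtain ⟨ε, hε, hball⟩ := Metric.mem_nhds_iff.1 hnhds
  rw [Real.ball_eq_Ioo, zero_sub, zero_add] at hball
  refine ⟨(extChartAt I p).symm ∘ c, ?_, ε, hε, ?_, ?_⟩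
  · simp [hc0]
  · exact (contMDiffOn_extChartAt_symm p).comp hc.contMDiff.contMDiffOn hball
  · have h1 : MDifferentiableAt 𝓘(ℝ, E) I (extChartAt I p).symm (c 0) :=
      mdifferentiableAt_extChartAt_symm (hc0 ▸ mem_extChartAt_target p)
    have h2 := h1.hasMFDerivAt.comp (0 : ℝ) hd.hasFDerivAt.hasMFDerivAt
    refine (DFunLike.congr_fun h2.mfderiv (1 : ℝ)).trans ?_
    have h3 := mfderiv_symm_mfderiv_extChartAt (mem_extChartAt_source (I := I) p) u
    refine Eq.trans ?_ h3
    have h4 : (mfderiv 𝓘(ℝ, E) I (extChartAt I p).symm (c 0) : E →L[ℝ] E) =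
      mfderiv 𝓘(ℝ, E) I (extChartAt I p).symm (extChartAt I p p) := mfderiv_congr_point hc0
    refine (DFunLike.congr_fun h4 _).trans ?_
    refine congrArg (mfderiv 𝓘(ℝ, E) I (extChartAt I p).symm (extChartAt I p p)) ?_
    exact one_smul ℝ w

/-- A curve `γ` in the image equals `F ∘ (ρ ∘ γ)`, where `ρ ∘ γ` is differentiable because `ρ` is
smooth. So its velocity is in the range of the derivative of `F`. -/
lemma tangentVectors_range {F : M → N} {ρ : N → M} (hF : ContMDiff I J ∞ F)
    (hρ : ContMDiff J I ∞ ρ) (h : Function.LeftInverse ρ F) (p : M) :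
    tangentVectors J (Set.range F) (F p) = Set.range (mfderiv I J F p) := by
  ext v
  constructor
  · rintro ⟨γ, hγ0, ⟨ε, hε, hγ, hmem⟩, rfl⟩
    have hnhds : Set.Ioo (-ε) ε ∈ 𝓝 (0 : ℝ) := Ioo_mem_nhds (by linarith) hε
    have hd : MDifferentiableAt 𝓘(ℝ, ℝ) J γ 0 :=
      (hγ.contMDiffAt hnhds).mdifferentiableAt (by simp)
    have hd' : MDifferentiableAt 𝓘(ℝ, ℝ) I (ρ ∘ γ) 0 :=
      (hρ.mdifferentiableAt (by simp)).comp 0 hd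
    have heq : γ =ᶠ[𝓝 0] F ∘ (ρ ∘ γ) := by
      filter_upwards [hnhds] with s hs
      obtain ⟨q, hq⟩ := hmem s hs
      simp only [Function.comp, ← hq, h q]
    have hp : (ρ ∘ γ) 0 = p := by simp only [Function.comp, hγ0, h p]
    have h1 := (hF.mdifferentiableAt (x := (ρ ∘ γ) 0) (by simp)).hasMFDerivAt.comp (0 : ℝ)
      hd'.hasMFDerivAt
    have h2 : (mfderiv I J F ((ρ ∘ γ) 0) : E →L[ℝ] E') = mfderiv I J F p := mfderiv_congr_point hp
    refine ⟨mfderiv 𝓘(ℝ, ℝ) I (ρ ∘ γ) 0 (1 : ℝ), ?_⟩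
    refine (DFunLike.congr_fun h2 _).symm.trans ?_
    refine (DFunLike.congr_fun h1.mfderiv (1 : ℝ)).symm.trans ?_
    exact (DFunLike.congr_fun (heq.mfderiv_eq (I := 𝓘(ℝ, ℝ)) (I' := J)) (1 : ℝ)).symm
  · rintro ⟨u, rfl⟩
    obtain ⟨γ, rfl, ε, hε, hγ, rfl⟩ := exists_curve p u
    refine ⟨F ∘ γ, rfl, ⟨ε, hε, hF.comp_contMDiffOn hγ, fun s _ => ⟨_, rfl⟩⟩, ?_⟩
    have hnhds : Set.Ioo (-ε) ε ∈ 𝓝 (0 : ℝ) := Ioo_mem_nhds (by linarith) hε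
    have hd : MDifferentiableAt 𝓘(ℝ, ℝ) I γ 0 :=
      (hγ.contMDiffAt hnhds).mdifferentiableAt (by simp)
    have h1 := (hF.mdifferentiableAt (x := γ 0) (by simp)).hasMFDerivAt.comp (0 : ℝ)
      hd.hasMFDerivAt
    exact DFunLike.congr_fun h1.mfderiv (1 : ℝ)

end TangentVectors

/-! ### The image of `X × f` as a submanifold, and the equivalence -/

section Legendrian

set_option linter.unusedSectionVars false

variable {E H M : Type*} [NormedAddCommGroup E] [NormedSpace ℝ E] [TopologicalSpace H]
  {I : ModelWithCorners ℝ E H} [TopologicalSpace M] [ChartedSpace H M]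

lemma reeb_spec {η : OneForm I M} {p : M} (h : IsContactPair (extD I η p) (η p)) :
    extD I η p (reeb I η p) = 0 ∧ η p (reeb I η p) = 1 :=
  Classical.epsilon_spec h.exists_reeb

variable [I.Boundaryless] [IsManifold I ∞ M] {X : VField I M} {f : M → ℝ}

lemma contMDiff_tangentBundle_prod_proj :
    ContMDiff (I.tangent.prod 𝓘(ℝ, ℝ)) I ∞ (fun x : TangentBundle I M × ℝ => x.1.proj) :=
  (contMDiff_proj (TangentSpace I)).comp contMDiff_fst

/-- The image is a graph over `M`. In a trivialization its defining function is the fibre coordinate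
minus that of `X`, together with `t - f`; the codimension is therefore `dim E + 1`. -/
lemma isSubmanifold_range_vfieldProd [FiniteDimensional ℝ E] (hX : IsSmoothVField I X)
    (hf : ContMDiff I 𝓘(ℝ, ℝ) ∞ f) :
    IsSubmanifold (I.tangent.prod 𝓘(ℝ, ℝ)) (Set.range (vfieldProd I X f)) := by
  let L : (E × ℝ) ≃L[ℝ] (Fin (Module.finrank ℝ E + 1) → ℝ) :=
    ContinuousLinearEquiv.ofFinrankEq (by simp)
  refine ⟨Module.finrank ℝ E + 1, fun x _ => ?_⟩
  let e := trivializationAt E (TangentSpace I : M → Type _) x.1.proj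
  let Ψ : TangentBundle I M × ℝ → E × ℝ := fun r =>
    ((e r.1).2 - (e ⟨r.1.proj, X r.1.proj⟩).2, r.2 - f r.1.proj)
  let U : Set (TangentBundle I M × ℝ) := (fun r => r.1.proj) ⁻¹' e.baseSet
  have hU : IsOpen U := e.open_baseSet.preimage contMDiff_tangentBundle_prod_proj.continuous
  have he : ContMDiffOn I.tangent 𝓘(ℝ, E) ∞ (fun w : TangentBundle I M => (e w).2) e.source :=
    contMDiff_snd.comp_contMDiffOn (e.contMDiffOn (IB := I))
  have hΨ : ContMDiffOn (I.tangent.prod 𝓘(ℝ, ℝ)) 𝓘(ℝ, E × ℝ) ∞ Ψ U := by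
    refine ContMDiffOn.prodMk_space ?_ ?_
    · refine ContMDiffOn.sub ?_ ?_
      · exact he.comp contMDiff_fst.contMDiffOn fun r hr => e.mem_source.2 hr
      · exact he.comp (hX.comp contMDiff_tangentBundle_prod_proj).contMDiffOn
          fun r hr => e.mem_source.2 hr
    · exact (contMDiff_snd.sub (hf.comp contMDiff_tangentBundle_prod_proj)).contMDiffOn
  have hΦ : ContMDiffOn (I.tangent.prod 𝓘(ℝ, ℝ)) 𝓘(ℝ, Fin (Module.finrank ℝ E + 1) → ℝ) ∞
      (L ∘ Ψ) U := L.contDiff.contMDiff.comp_contMDiffOn hΨ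
  refine ⟨U, hU, mem_baseSet_trivializationAt E (TangentSpace I) x.1.proj, L ∘ Ψ, hΦ, ?_, ?_⟩
  · intro y hy c
    -- `S` parametrizes the fibre through `y`. Along it `Ψ` is a translation, so `L ∘ Ψ ∘ S` has
    -- derivative `L`, which makes the derivative of `L ∘ Ψ` surjective.
    let S : E × ℝ → TangentBundle I M × ℝ := fun z =>
      (e.toOpenPartialHomeomorph.symm (y.1.proj, z.1), z.2)
    have hy' : y.1.proj ∈ e.baseSet := hy
    have hS : ContMDiff 𝓘(ℝ, E × ℝ) (I.tangent.prod 𝓘(ℝ, ℝ)) ∞ S := by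
      refine ContMDiff.prodMk ?_ contDiff_snd.contMDiff
      rw [← contMDiffOn_univ]
      refine (e.contMDiffOn_symm (IB := I)).comp
        (contMDiff_const.prodMk contDiff_fst.contMDiff).contMDiffOn fun z _ => ?_
      exact e.mem_target.2 hy'
    have hproj (z : E × ℝ) : (S z).1.proj = y.1.proj := e.proj_symm_apply' hy'
    have hΨS (z : E × ℝ) : Ψ (S z) = z - ((e ⟨y.1.proj, X y.1.proj⟩).2, f y.1.proj) := by
      have h1 : (e (S z).1).2 = z.1 := by
        have := e.apply_symm_apply' (x := (z.1)) hy'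
        exact congrArg Prod.snd this
      simp only [Ψ, h1, hproj]
      rfl
    have hSy : S ((e y.1).2, y.2) = y := by
      refine Prod.ext ?_ rfl
      exact e.symm_apply_mk_proj (e.mem_source.2 hy')
    let z₀ : E × ℝ := ((e y.1).2, y.2)
    have hd : HasMFDerivAt 𝓘(ℝ, E × ℝ) 𝓘(ℝ, Fin (Module.finrank ℝ E + 1) → ℝ) ((L ∘ Ψ) ∘ S) z₀
        (L : (E × ℝ) →L[ℝ] (Fin (Module.finrank ℝ E + 1) → ℝ)) := by
      have h1 : (L ∘ Ψ) ∘ S = fun z => L (z - ((e ⟨y.1.proj, X y.1.proj⟩).2, f y.1.proj)) := by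
        funext z
        exact congrArg L (hΨS z)
      rw [h1]
      have h2 := L.hasFDerivAt.comp z₀ ((hasFDerivAt_id z₀).sub_const
        ((e ⟨y.1.proj, X y.1.proj⟩).2, f y.1.proj))
      exact h2.hasMFDerivAt
    have hΦy : MDifferentiableAt (I.tangent.prod 𝓘(ℝ, ℝ))
        𝓘(ℝ, Fin (Module.finrank ℝ E + 1) → ℝ) (L ∘ Ψ) (S z₀) := by
      rw [hSy]
      exact (hΦ.contMDiffAt (hU.mem_nhds hy)).mdifferentiableAt (by simp)
    have h3 := hΦy.hasMFDerivAt.comp z₀ (hS.mdifferentiableAt (by simp)).hasMFDerivAt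
    have h4 := hasMFDerivAt_unique hd h3
    have h5 : (mfderiv (I.tangent.prod 𝓘(ℝ, ℝ)) 𝓘(ℝ, Fin (Module.finrank ℝ E + 1) → ℝ) (L ∘ Ψ)
      (S z₀) : (E × E) × ℝ →L[ℝ] (Fin (Module.finrank ℝ E + 1) → ℝ)) =
      mfderiv (I.tangent.prod 𝓘(ℝ, ℝ)) 𝓘(ℝ, Fin (Module.finrank ℝ E + 1) → ℝ) (L ∘ Ψ) y :=
      mfderiv_congr_point hSy
    refine ⟨mfderiv 𝓘(ℝ, E × ℝ) (I.tangent.prod 𝓘(ℝ, ℝ)) S z₀ (L.symm c), ?_⟩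
    refine (DFunLike.congr_fun h5 _).symm.trans ?_
    refine (DFunLike.congr_fun h4 (L.symm c)).symm.trans ?_
    exact L.apply_symm_apply c
  · intro y hy
    have hy' : y.1.proj ∈ e.baseSet := hy
    have h0 : (L ∘ Ψ) y = 0 ↔ Ψ y = 0 := L.map_eq_zero_iff
    rw [h0]
    constructor
    · rintro ⟨q, rfl⟩
      simp only [Ψ, vfieldProd, sub_self]
      rfl
    · intro h
      have h1 : (e y.1).2 = (e ⟨y.1.proj, X y.1.proj⟩).2 := sub_eq_zero.1 (congrArg Prod.fst h)
      have h2 : y.2 = f y.1.proj := sub_eq_zero.1 (congrArg Prod.snd h)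
      refine ⟨y.1.proj, Prod.ext ?_ h2.symm⟩
      have hm : (⟨y.1.proj, X y.1.proj⟩ : TangentBundle I M) ∈ e.source := e.mem_source.2 hy'
      refine e.injOn hm (e.mem_source.2 hy') (Prod.ext ?_ h1.symm)
      exact (e.coe_fst hm).trans (e.coe_fst' hy').symm

/-- The image of `X × f` is Legendrian iff `(-f, X)` is an infinitesimal conformal
contactomorphism. -/
theorem isInfConformalContacto_iff_isLegendrian {n : ℕ} {η : OneForm I M}
    (hη : IsContactForm I n η) (hX : IsSmoothVField I X) (hf : ContMDiff I 𝓘(ℝ, ℝ) ∞ f) :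
    IsInfConformalContacto I η (fun p => -f p) X ↔
      IsLegendrian (I.tangent.prod 𝓘(ℝ, ℝ)) (contactification I η)
        (Set.range (vfieldProd I X f)) := by
  have : FiniteDimensional ℝ E := hη.finiteDimensional
  have hpair (x : TangentBundle I M × ℝ) := isContactPair_contactification hη.smooth x
    (hη.isContactPair x.1.proj)
  have hT (p : M) := tangentVectors_range (contMDiff_vfieldProd hX hf)
    contMDiff_tangentBundle_prod_proj (fun _ => rfl) p
  have hfin (x : TangentBundle I M × ℝ) :
      FiniteDimensional ℝ (TangentSpace (I.tangent.prod 𝓘(ℝ, ℝ)) x) :=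
    inferInstanceAs (FiniteDimensional ℝ ((E × E) × ℝ))
  have hfin' (p : M) : FiniteDimensional ℝ (TangentSpace I p) :=
    inferInstanceAs (FiniteDimensional ℝ E)
  have hT2 (x : TangentBundle I M × ℝ) :
      T2Space (TangentSpace (I.tangent.prod 𝓘(ℝ, ℝ)) x) :=
    inferInstanceAs (T2Space ((E × E) × ℝ))
  rw [isInfConformalContacto_iff hη.smooth hX hf]
  constructor
  · intro h
    refine ⟨isSubmanifold_range_vfieldProd hX hf, ?_⟩
    rintro _ ⟨p, rfl⟩
    rw [hT]
    have hdim : Module.finrank ℝ (TangentSpace (I.tangent.prod 𝓘(ℝ, ℝ)) (vfieldProd I X f p)) =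
        2 * Module.finrank ℝ (TangentSpace I p) + 1 := by
      change Module.finrank ℝ ((E × E) × ℝ) = 2 * Module.finrank ℝ E + 1
      rw [Module.finrank_prod, Module.finrank_prod, Module.finrank_self]
      ring
    exact (hpair (vfieldProd I X f p)).range_eq_sharpJacobi_image
      (reeb_spec (hpair _)).1 (reeb_spec (hpair _)).2
      (mfderiv I (I.tangent.prod 𝓘(ℝ, ℝ)) (vfieldProd I X f) p).toLinearMap
      (mfderiv_vfieldProd_injective hX hf p) hdim (h p)
      (extD_contactification_mfderiv hη.smooth hX hf h p)
  · rintro ⟨-, h⟩ p u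
    have h1 : mfderiv I (I.tangent.prod 𝓘(ℝ, ℝ)) (vfieldProd I X f) p u ∈
        tangentVectors (I.tangent.prod 𝓘(ℝ, ℝ)) (Set.range (vfieldProd I X f))
          (vfieldProd I X f p) := by
      rw [hT]; exact ⟨u, rfl⟩
    rw [h _ ⟨p, rfl⟩] at h1
    obtain ⟨α, -, hα⟩ := h1
    rw [← hα]
    exact (hpair _).form_sharpJacobi (reeb_spec (hpair _)).1 (reeb_spec (hpair _)).2 α

end Legendrian

/-! ### Smooth inversion of `♭` in coordinates -/

section ModelSpace

variable {E : Type*} [NormedAddCommGroup E] [NormedSpace ℝ E]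

/-- The map `♭` of the one-form `α` on a normed space. -/
def flatForm (α : E → E →L[ℝ] ℝ) (y : E) : E →L[ℝ] E →L[ℝ] ℝ :=
  curl α y + (α y).smulRight (α y)

lemma contDiff_flip : ContDiff ℝ ∞ (fun B : E →L[ℝ] E →L[ℝ] ℝ => B.flip) :=
  IsBoundedLinearMap.contDiff (E := E →L[ℝ] E →L[ℝ] ℝ) (F := E →L[ℝ] E →L[ℝ] ℝ)
    (IsLinearMap.with_bound ⟨fun _ _ => rfl, fun _ _ => rfl⟩ 1
      fun B => by rw [ContinuousLinearMap.opNorm_flip, one_mul])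

lemma contDiffAt_flatForm {α : E → E →L[ℝ] ℝ} {y : E} (hα : ContDiffAt ℝ ∞ α y) :
    ContDiffAt ℝ ∞ (flatForm α) y := by
  have h1 : ContDiffAt ℝ ∞ (fderiv ℝ α) y := hα.fderiv_right (by simp)
  have h2 : ContDiffAt ℝ ∞ (fun z => (fderiv ℝ α z).flip) y :=
    ContDiffAt.comp y (g := fun B : E →L[ℝ] E →L[ℝ] ℝ => B.flip) contDiff_flip.contDiffAt h1
  exact (h1.sub h2).add (hα.smulRight hα)

lemma contDiffAt_inverse_flatForm [FiniteDimensional ℝ E] {α : E → E →L[ℝ] ℝ} {y : E}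
    (hα : ContDiffAt ℝ ∞ α y)
    (h : IsContactPair (curl α y) (α y)) :
    ContDiffAt ℝ ∞ (fun z => (flatForm α z).inverse) y := by
  have : CompleteSpace E := FiniteDimensional.complete ℝ E
  obtain ⟨e, he⟩ := h.exists_equiv
  have h1 : ContDiffAt ℝ ∞ ContinuousLinearMap.inverse (flatForm α y) := by
    rw [flatForm, ← he]
    exact contDiffAt_map_inverse e
  exact h1.comp y (contDiffAt_flatForm hα)

/-- `inverse` is zero at operators that are not invertible, so it must be known that `♭` stays
invertible near `y`. This holds because invertible operators form an open set. -/
lemma eventually_flatForm_inverse [FiniteDimensional ℝ E] {α : E → E →L[ℝ] ℝ} {y : E}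
    (hα : ContDiffAt ℝ ∞ α y) (h : IsContactPair (curl α y) (α y)) :
    ∀ᶠ z in 𝓝 y, ∀ β, flatForm α z ((flatForm α z).inverse β) = β := by
  have : CompleteSpace E := FiniteDimensional.complete ℝ E
  obtain ⟨e, he⟩ := h.exists_equiv
  have h1 : flatForm α ⁻¹' (Set.range ((↑) : (E ≃L[ℝ] (E →L[ℝ] ℝ)) → E →L[ℝ] E →L[ℝ] ℝ)) ∈ 𝓝 y := by
    refine (contDiffAt_flatForm hα).continuousAt.preimage_mem_nhds ?_
    rw [flatForm, ← he]
    exact e.nhds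
  filter_upwards [h1] with z ⟨e', he'⟩ β
  rw [← he']
  simp

end ModelSpace

/-! ### The contact Hamiltonian vector field: smoothness and conformality -/

section Hamiltonian

set_option linter.unusedSectionVars false

variable {E H M : Type*} [NormedAddCommGroup E] [NormedSpace ℝ E] [TopologicalSpace H]
  {I : ModelWithCorners ℝ E H} [TopologicalSpace M] [ChartedSpace H M]
  [I.Boundaryless] [IsManifold I ∞ M]

lemma contMDiffAt_vfield_of_chart {V : VField I M} {p : M} {W : E → E}
    (hW : ContDiffAt ℝ ∞ W (extChartAt I p p))
    (h : ∀ᶠ y in 𝓝 (extChartAt I p p),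
      V ((extChartAt I p).symm y) = mfderiv 𝓘(ℝ, E) I (extChartAt I p).symm y (W y)) :
    ContMDiffAt I I.tangent ∞ (fun q => (⟨q, V q⟩ : TangentBundle I M)) p := by
  have : IsManifold I 1 M := .of_le (n := ∞) (by norm_cast)
  have hφ : ContMDiffAt I 𝓘(ℝ, E) ∞ (extChartAt I p) p := contMDiffAt_extChartAt
  have hpair : ContMDiffAt I 𝓘(ℝ, E × E) ∞ (fun q => (extChartAt I p q, W (extChartAt I p q))) p :=
    hφ.prodMk_space (hW.contMDiffAt.comp p hφ)
  -- The zero vector serves only to select a chart of `TM`: that chart is determined by the base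
  -- point and covers whole fibres.
  have hsymm : ContMDiffAt 𝓘(ℝ, E × E) I.tangent ∞
      (extChartAt I.tangent (⟨p, 0⟩ : TangentBundle I M)).symm
      (extChartAt I p p, W (extChartAt I p p)) := by
    refine contMDiffAt_extChartAt_symm ?_
    rw [FiberBundle.extChartAt_target]
    exact ⟨⟨mem_extChartAt_target p, by
      have := mem_extChartAt_source (I := I) p
      rw [extChartAt_source] at this
      change (extChartAt I p).symm (extChartAt I p p) ∈ (chartAt H p).source
      rwa [extChartAt_to_inv]⟩, trivial⟩
  refine (ContMDiffAt.comp p hsymm hpair).congr_of_eventuallyEq ?_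
  filter_upwards [hφ.continuousAt.eventually h, extChartAt_source_mem_nhds (I := I) p] with q hq hq'
  have h1 := tangentBundle_extChartAt_symm (⟨p, 0⟩ : TangentBundle I M)
    ((extChartAt I p).map_source hq') (W (extChartAt I p q))
  refine Eq.trans ?_ h1.symm
  change _ = (⟨(extChartAt I p).symm (extChartAt I p q), _⟩ : TangentBundle I M)
  rw [← hq, (extChartAt I p).left_inv hq']

lemma contMDiffAt_of_chart {g : M → ℝ} {p : M} {W : E → ℝ}
    (hW : ContDiffAt ℝ ∞ W (extChartAt I p p))
    (h : ∀ᶠ y in 𝓝 (extChartAt I p p), g ((extChartAt I p).symm y) = W y) :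
    ContMDiffAt I 𝓘(ℝ, ℝ) ∞ g p := by
  have hφ : ContMDiffAt I 𝓘(ℝ, E) ∞ (extChartAt I p) p := contMDiffAt_extChartAt
  refine (hW.contMDiffAt.comp p hφ).congr_of_eventuallyEq ?_
  filter_upwards [hφ.continuousAt.eventually h, extChartAt_source_mem_nhds (I := I) p] with q hq hq'
  rw [Function.comp, ← hq, (extChartAt I p).left_inv hq']

lemma flat_mfderiv_symm {η : OneForm I M} (hη : IsSmoothOneForm I η) {p : M} {y : E}
    (hy : y ∈ (extChartAt I p).target) (v w : E) :
    flat I η ((extChartAt I p).symm y) (mfderiv 𝓘(ℝ, E) I (extChartAt I p).symm y v)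
      (mfderiv 𝓘(ℝ, E) I (extChartAt I p).symm y w) =
    flatForm (OneForm.inChart I η p) y v w := by
  have h := extD_mfderiv_symm hη hy v w
  exact congrArg (· + OneForm.inChart I η p y v * OneForm.inChart I η p y w) h

lemma exists_mfderiv_symm_eq {p : M} {y : E} (hy : y ∈ (extChartAt I p).target)
    (u : TangentSpace I ((extChartAt I p).symm y)) :
    ∃ w : E, mfderiv 𝓘(ℝ, E) I (extChartAt I p).symm y w = u := by
  have : IsManifold I 1 M := .of_le (n := ∞) (by norm_cast)
  have h := mfderivWithin_extChartAt_symm_comp_mfderiv_extChartAt (I := I) hy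
  rw [I.range_eq_univ, mfderivWithin_univ] at h
  exact ⟨_, DFunLike.congr_fun h u⟩

variable {n : ℕ} {η : OneForm I M}

/-- `flatForm` is `♭` transported to the chart, and `♭` is injective at every point, so `♯` can be
computed in the chart as well. -/
lemma sharp_symm (hη : IsContactForm I n η) {p : M} {y : E}
    (hy : y ∈ (extChartAt I p).target)
    (hinv : ∀ β, flatForm (OneForm.inChart I η p) y
      ((flatForm (OneForm.inChart I η p) y).inverse β) = β)
    (β : TangentSpace I ((extChartAt I p).symm y) →L[ℝ] ℝ) (β' : E →L[ℝ] ℝ)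
    (hβ : ∀ w : E, β (mfderiv 𝓘(ℝ, E) I (extChartAt I p).symm y w) = β' w) :
    sharp I η ((extChartAt I p).symm y) β = mfderiv 𝓘(ℝ, E) I (extChartAt I p).symm y
      ((flatForm (OneForm.inChart I η p) y).inverse β') := by
  have : FiniteDimensional ℝ E := hη.finiteDimensional
  have hfin : FiniteDimensional ℝ (TangentSpace I ((extChartAt I p).symm y)) :=
    inferInstanceAs (FiniteDimensional ℝ E)
  have hT2 : T2Space (TangentSpace I ((extChartAt I p).symm y)) := inferInstanceAs (T2Space E)
  have h1 : flat I η ((extChartAt I p).symm y) (mfderiv 𝓘(ℝ, E) I (extChartAt I p).symm y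
      ((flatForm (OneForm.inChart I η p) y).inverse β')) = β := by
    refine ContinuousLinearMap.ext fun u => ?_
    obtain ⟨w, rfl⟩ := exists_mfderiv_symm_eq hy u
    rw [hβ]
    exact (flat_mfderiv_symm hη.smooth hy _ w).trans (DFunLike.congr_fun (hinv β') w)
  rw [← h1]
  exact (hη.isContactPair _).sharp_flat _

/-- `♭(R) = i_R dη + η(R) η = η`. This turns the Reeb field, defined pointwise by choice, into an
expression whose smoothness can be read off in charts. -/
lemma sharp_self (hη : IsContactForm I n η) (p : M) : sharp I η p (η p) = reeb I η p := by
  have : FiniteDimensional ℝ E := hη.finiteDimensional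
  have hfin : FiniteDimensional ℝ (TangentSpace I p) := inferInstanceAs (FiniteDimensional ℝ E)
  have hT2 : T2Space (TangentSpace I p) := inferInstanceAs (T2Space E)
  obtain ⟨hr, hr'⟩ := reeb_spec (hη.isContactPair p)
  have h1 : flat I η p (reeb I η p) = η p := by
    rw [flat, add_apply, hr, ContinuousLinearMap.smulRight_apply, hr']
    simp
  conv_lhs => rw [← h1]
  exact (hη.isContactPair p).sharp_flat _

lemma diff_mfderiv_symm {h : M → ℝ} (hh : ContMDiff I 𝓘(ℝ, ℝ) ∞ h) {p : M} {y : E}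
    (hy : y ∈ (extChartAt I p).target) (w : E) :
    diff I h ((extChartAt I p).symm y) (mfderiv 𝓘(ℝ, E) I (extChartAt I p).symm y w) =
      fderiv ℝ (h ∘ (extChartAt I p).symm) y w := by
  have : IsManifold I 1 M := .of_le (n := ∞) (by norm_cast)
  have h1 := mfderiv_comp y (hh.mdifferentiableAt (x := (extChartAt I p).symm y) (by simp))
    (mdifferentiableAt_extChartAt_symm (I := I) hy)
  rw [mfderiv_eq_fderiv] at h1
  exact (DFunLike.congr_fun h1 w).symm

/-- Local expressions of the Reeb vector field and of `♯ dh`. -/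
lemma exists_chart_reeb_sharp (hη : IsContactForm I n η) {h : M → ℝ}
    (hh : ContMDiff I 𝓘(ℝ, ℝ) ∞ h) (p : M) :
    ∃ r s : E → E, ContDiffAt ℝ ∞ r (extChartAt I p p) ∧ ContDiffAt ℝ ∞ s (extChartAt I p p) ∧
      ∀ᶠ y in 𝓝 (extChartAt I p p),
        reeb I η ((extChartAt I p).symm y) = mfderiv 𝓘(ℝ, E) I (extChartAt I p).symm y (r y) ∧
        sharp I η ((extChartAt I p).symm y) (diff I h ((extChartAt I p).symm y)) =
          mfderiv 𝓘(ℝ, E) I (extChartAt I p).symm y (s y) ∧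
        reebDeriv I η h ((extChartAt I p).symm y) =
          fderiv ℝ (h ∘ (extChartAt I p).symm) y (r y) := by
  have : IsManifold I 1 M := .of_le (n := ∞) (by norm_cast)
  have : FiniteDimensional ℝ E := hη.finiteDimensional
  have hα : ContDiffAt ℝ ∞ (OneForm.inChart I η p) (extChartAt I p p) :=
    (hη.smooth.contDiffOn_inChart p).contDiffAt (extChartAt_target_mem_nhds p)
  have hpair := (isContactPair_iff_inChart η p).1 (hη.isContactPair p)
  have hinv := contDiffAt_inverse_flatForm hα hpair
  have hh' : ContDiffAt ℝ ∞ (h ∘ (extChartAt I p).symm) (extChartAt I p p) :=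
    ((hh _).comp _ (contMDiffAt_extChartAt_symm (mem_extChartAt_target p))).contDiffAt
  refine ⟨fun y => (flatForm (OneForm.inChart I η p) y).inverse (OneForm.inChart I η p y),
    fun y => (flatForm (OneForm.inChart I η p) y).inverse (fderiv ℝ (h ∘ (extChartAt I p).symm) y),
    hinv.clm_apply hα, hinv.clm_apply (hh'.fderiv_right (by simp)), ?_⟩
  filter_upwards [eventually_flatForm_inverse hα hpair,
    (isOpen_extChartAt_target p).mem_nhds (mem_extChartAt_target p)] with y hy hy'
  have hr : reeb I η ((extChartAt I p).symm y) = mfderiv 𝓘(ℝ, E) I (extChartAt I p).symm y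
      ((flatForm (OneForm.inChart I η p) y).inverse (OneForm.inChart I η p y)) := by
    rw [← sharp_self hη]
    exact sharp_symm hη hy' hy _ _ fun w => rfl
  refine ⟨hr, sharp_symm hη hy' hy _ _ (diff_mfderiv_symm hh hy'), ?_⟩
  rw [reebDeriv, hr]
  exact diff_mfderiv_symm hh hy' _

lemma contMDiff_reebDeriv (hη : IsContactForm I n η) {h : M → ℝ}
    (hh : ContMDiff I 𝓘(ℝ, ℝ) ∞ h) : ContMDiff I 𝓘(ℝ, ℝ) ∞ (reebDeriv I η h) := by
  intro p
  obtain ⟨r, s, hr, -, hev⟩ := exists_chart_reeb_sharp hη hh p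
  have hh' : ContDiffAt ℝ ∞ (h ∘ (extChartAt I p).symm) (extChartAt I p p) :=
    ((hh _).comp _ (contMDiffAt_extChartAt_symm (mem_extChartAt_target p))).contDiffAt
  exact contMDiffAt_of_chart ((hh'.fderiv_right (by simp)).clm_apply hr)
    (hev.mono fun y hy => hy.2.2)

lemma isSmoothVField_hamiltonianVField (hη : IsContactForm I n η) {h : M → ℝ}
    (hh : ContMDiff I 𝓘(ℝ, ℝ) ∞ h) : IsSmoothVField I (hamiltonianVField I η h) := by
  intro p
  obtain ⟨r, s, hr, hs, hev⟩ := exists_chart_reeb_sharp hη hh p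
  have hh' : ContDiffAt ℝ ∞ (h ∘ (extChartAt I p).symm) (extChartAt I p p) :=
    ((hh _).comp _ (contMDiffAt_extChartAt_symm (mem_extChartAt_target p))).contDiffAt
  refine contMDiffAt_vfield_of_chart (W := fun y => s y -
    fderiv ℝ (h ∘ (extChartAt I p).symm) y (r y) • r y - (h ∘ (extChartAt I p).symm) y • r y)
    ((hs.sub (((hh'.fderiv_right (by simp)).clm_apply hr).smul hr)).sub (hh'.smul hr)) ?_
  filter_upwards [hev] with y ⟨h1, h2, h3⟩
  have h4 : hamiltonianVField I η h ((extChartAt I p).symm y) =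
      sharp I η ((extChartAt I p).symm y) (diff I h ((extChartAt I p).symm y)) -
      reebDeriv I η h ((extChartAt I p).symm y) • reeb I η ((extChartAt I p).symm y) -
      h ((extChartAt I p).symm y) • reeb I η ((extChartAt I p).symm y) := rfl
  rw [h4, h3, h2, h1]
  have key {V : Type _} [AddCommGroup V] [Module ℝ V] [TopologicalSpace V] (D : E →L[ℝ] V)
      (a b : E) (c d : ℝ) : D a - c • D b - d • D b = D (a - c • b - d • b) := by simp
  exact key _ _ _ _ _

lemma isInfConformalContacto_hamiltonianVField (hη : IsContactForm I n η) {h : M → ℝ}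
    (hh : ContMDiff I 𝓘(ℝ, ℝ) ∞ h) :
    IsInfConformalContacto I η (fun p => -reebDeriv I η h p) (hamiltonianVField I η h) := by
  intro p
  have : FiniteDimensional ℝ E := hη.finiteDimensional
  have hfin (p : M) : FiniteDimensional ℝ (TangentSpace I p) :=
    inferInstanceAs (FiniteDimensional ℝ E)
  have hT2 (p : M) : T2Space (TangentSpace I p) := inferInstanceAs (T2Space E)
  have hr (p : M) := reeb_spec (hη.isContactPair p)
  -- `♯_Λ(dh)` lies in `ker η`, so only the Reeb component contributes.
  have h1 : (fun q => η q (hamiltonianVField I η h q)) = fun q => -h q := by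
    funext q
    have := (hη.isContactPair q).form_sharpJacobi (hr q).1 (hr q).2 (diff I h q)
    change η q (sharpJacobi I η q (diff I h q)) = 0 at this
    rw [hamiltonianVField, map_sub, this, map_smul, (hr q).2]
    simp
  have h2 : diff I (fun q => -h q) p = -diff I h p :=
    ((hh.mdifferentiableAt (x := p) (by simp)).hasMFDerivAt.neg).mfderiv
  -- The Reeb component is killed by `dη`, so only `♯_Λ(dh)` contributes. In Cartan's formula the
  -- two `dh` terms then cancel.
  have h3 : extD I η p (hamiltonianVField I η h p) =
      diff I h p - reebDeriv I η h p • η p := by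
    have := (hη.isContactPair p).skewForm_sharpJacobi (hr p).1 (hr p).2 (diff I h p)
    change extD I η p (sharpJacobi I η p (diff I h p)) = _ at this
    rw [hamiltonianVField, map_sub, this, map_smul, (hr p).1, smul_zero, sub_zero]
    rfl
  rw [lieDeriv, h1, h2, h3]
  refine ContinuousLinearMap.ext fun u => ?_
  change diff I h p u - reebDeriv I η h p * η p u + -diff I h p u = -reebDeriv I η h p * η p u
  ring

end Hamiltonian

end ContactGeometry

end

theorem mainTheorem6 {n : ℕ} {E : Type*} [NormedAddCommGroup E] [NormedSpace ℝ E]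
    {M : Type*} [TopologicalSpace M] [ChartedSpace E M] [IsManifold 𝓘(ℝ, E) ∞ M]
    (η : ContactGeometry.OneForm 𝓘(ℝ, E) M)
    (hη : ContactGeometry.IsContactForm 𝓘(ℝ, E) n η) :
    (∀ (X : ContactGeometry.VField 𝓘(ℝ, E) M) (f : M → ℝ),
      ContactGeometry.IsSmoothVField 𝓘(ℝ, E) X → ContMDiff 𝓘(ℝ, E) 𝓘(ℝ, ℝ) ∞ f →
      (ContactGeometry.IsInfConformalContacto 𝓘(ℝ, E) η (fun p => -f p) X ↔
        ContactGeometry.IsLegendrian (𝓘(ℝ, E).tangent.prod 𝓘(ℝ, ℝ))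
          (ContactGeometry.contactification 𝓘(ℝ, E) η)
          (Set.range (ContactGeometry.vfieldProd 𝓘(ℝ, E) X f)))) ∧
    (∀ h : M → ℝ, ContMDiff 𝓘(ℝ, E) 𝓘(ℝ, ℝ) ∞ h →
      ContactGeometry.IsLegendrian (𝓘(ℝ, E).tangent.prod 𝓘(ℝ, ℝ))
        (ContactGeometry.contactification 𝓘(ℝ, E) η)
        (Set.range (ContactGeometry.vfieldProd 𝓘(ℝ, E)
          (ContactGeometry.hamiltonianVField 𝓘(ℝ, E) η h)
          (ContactGeometry.reebDeriv 𝓘(ℝ, E) η h)))) :=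
  ⟨fun _ _ hX hf => ContactGeometry.isInfConformalContacto_iff_isLegendrian hη hX hf,
    fun _ hh => (ContactGeometry.isInfConformalContacto_iff_isLegendrian hη
      (ContactGeometry.isSmoothVField_hamiltonianVField hη hh)
      (ContactGeometry.contMDiff_reebDeriv hη hh)).1
      (ContactGeometry.isInfConformalContacto_hamiltonianVField hη hh)⟩
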